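/- **Theorem 1.1.** A bijection between subsets of $\mathbb R$ or of the circle $\mathbb R/\mathbb Z$ is called *dyadic piecewise linear* if its domain can be cut into finitely many half-open intervals $[a,b)$ with dyadic rational endpoints (together with the endpoint $1$, if the domain is $[0,1]$) on each of which it has the form $x\mapsto 2^k x+c$ with $k\in\mathbb Z$ and $c$ a dyadic rational (modulo $1$ in the case of the circle). Let $F$ be the group of dyadic piecewise linear homeomorphisms of $[0,1]$, let $T$ be the group of dyadic piecewise linear homeomorphisms of $\mathbb R/\mathbb Z$, and let $V$ be the group of (not necessarily continuous) dyadic piecewise linear bijections of $[0,1)$. For $G\in\{F,T,V\}$ and a set $S$ let $G_S=\{g\in G : g(x)=x \text{ for all } x\in S\}$ (for $T$, $S\subseteq[0,1)$ is identified with its image in $\mathbb R/\mathbb Z$). For a locally finite graph $\Gamma$ let $e(\Gamma)=\sup_K |\mathrm{Comp}_\infty(\Gamma-K)|\in\{0,1,2,\dots,\infty\}$, where $K$ runs over the finite sets of vertices and $\mathrm{Comp}_\infty(\Gamma-K)$ is the set of infinite connected components of $\Gamma-K$. For a group $G$ with a finite generating set $\Sigma$ and a subgroup $H\le G$, let $\Gamma_\Sigma(H\backslash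 G)$ be the coset graph, whose vertices are the right cosets $Hg$ and whose edges join $Hg$ to $Hgs$ for $g\in G$, $s\in\Sigma$. Then the groups $F$, $T$ and $V$ are finitely generated, and the pairs $(F,F_{[0,1/2]})$, $(T,T_{[0,1/2]})$ and $(V,V_{[0,1/2)})$ all have infinitely many ends: for each of these pairs $(G,H)$ and every finite generating set $\Sigma$ of $G$, $$e(G,H)=e(\Gamma_\Sigma(H\backslash G))=\infty .$$ The same holds for the pairs $(F,F_{[0,1/2)})$ and $(T,T_{[0,1/2)})$. -/

import Mathlib

/-! ## Ends of graphs and of pairs of groups -/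

/-- The number of ends of a (locally finite) graph: the supremum, over all finite sets `K` of
vertices, of the number of infinite connected components of the complement of `K`. -/
noncomputable def numEnds {W : Type*} (Γ : SimpleGraph W) : ℕ∞ :=
  ⨆ K : Finset W, {C : Γ.ComponentCompl (K : Set W) | C.supp.Infinite}.encard

/-- The coset graph of `H \ G` with respect to `S`: the quotient of the Cayley graph of `G` (edges
from `g` to `g * s`) by the left action of `H`. The vertices are the right cosets `H g`; loops and
repeated edges, which do not affect the number of ends, are discarded. -/
def cosetGraph {G : Type*} [Group G] (H : Subgroup G) (S : Set G) :
    SimpleGraph (Quotient (QuotientGroup.rightRel H)) :=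
  SimpleGraph.fromRel fun u v => ∃ g : G, ∃ s ∈ S,
    u = Quotient.mk (QuotientGroup.rightRel H) g ∧
      v = Quotient.mk (QuotientGroup.rightRel H) (g * s)

/-- The relation `e(G, H) = n`: the group `G` is finitely generated, and its coset graph `H \ G`
with respect to any finite generating set has `n` ends. -/
def PairHasEnds {G : Type*} [Group G] (H : Subgroup G) (n : ℕ∞) : Prop :=
  Group.FG G ∧
    ∀ S : Finset G, Subgroup.closure (S : Set G) = ⊤ → numEnds (cosetGraph H (S : Set G)) = n

/-! ## Dyadic piecewise linear bijections -/

/-- Dyadic rational numbers. -/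
def IsDyadic (c : ℝ) : Prop := ∃ (a : ℤ) (n : ℕ), c = a / 2 ^ n

/-- `f` is affine on each piece of some finite subdivision with dyadic endpoints, of the form
`x ↦ 2 ^ k * x + c` there with `k` an integer and `c` dyadic. As every such subdivision has a
uniform refinement, the pieces are taken to be the intervals `[j / 2 ^ N, (j + 1) / 2 ^ N)`. -/
def IsDyadicPL {s : Set ℝ} (f : s → s) : Prop :=
  ∃ N : ℕ, ∀ j : ℤ, ∃ (k : ℤ) (c : ℝ), IsDyadic c ∧
    ∀ x : s, (j : ℝ) ≤ 2 ^ N * (x : ℝ) → 2 ^ N * (x : ℝ) < j + 1 →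
      (f x : ℝ) = (2 : ℝ) ^ k * (x : ℝ) + c

theorem IsDyadic.zpow_mul {c : ℝ} (hc : IsDyadic c) (k : ℤ) : IsDyadic (2 ^ k * c) := by
  obtain ⟨a, n, rfl⟩ := hc
  obtain ⟨t, ht⟩ : ∃ t : ℕ, (t : ℤ) = k + k.natAbs := ⟨(k + k.natAbs).toNat, by omega⟩
  have e : (2 : ℝ) ^ t = 2 ^ k * 2 ^ k.natAbs := by
    rw [← zpow_natCast, ← zpow_natCast, ← zpow_add₀ two_ne_zero, ht]
  refine ⟨a * 2 ^ t, n + k.natAbs, ?_⟩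
  push_cast
  rw [e]
  field_simp
  ring

theorem IsDyadic.add {c d : ℝ} (hc : IsDyadic c) (hd : IsDyadic d) : IsDyadic (c + d) := by
  obtain ⟨a, n, rfl⟩ := hc
  obtain ⟨b, m, rfl⟩ := hd
  refine ⟨a * 2 ^ m + b * 2 ^ n, n + m, ?_⟩
  push_cast
  field_simp
  ring

theorem IsDyadic.neg {c : ℝ} (hc : IsDyadic c) : IsDyadic (-c) := by
  obtain ⟨a, n, rfl⟩ := hc
  exact ⟨-a, n, by push_cast; ring⟩

theorem IsDyadic.cell {c : ℝ} (hc : IsDyadic c) (k : ℤ) (M : ℕ) :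
    ∃ R : ℕ, ∀ L : ℕ, R ≤ L → ∀ x y : ℝ, ⌊(2 : ℝ) ^ L * x⌋ = ⌊(2 : ℝ) ^ L * y⌋ →
      ⌊(2 : ℝ) ^ M * ((2 : ℝ) ^ k * x + c)⌋ = ⌊(2 : ℝ) ^ M * ((2 : ℝ) ^ k * y + c)⌋ := by
  obtain ⟨a, n, rfl⟩ := hc
  refine ⟨M + n + k.natAbs, fun L hL x y hxy => ?_⟩
  obtain ⟨r, hr⟩ : ∃ r : ℕ, (r : ℤ) = L - k - M := ⟨(L - k - M : ℤ).toNat, by omega⟩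
  obtain ⟨t, ht⟩ : ∃ t : ℕ, (t : ℤ) = L - k - n := ⟨(L - k - n : ℤ).toNat, by omega⟩
  have h2 : (2 : ℝ) ≠ 0 := two_ne_zero
  have key : ∀ z : ℝ, (2 : ℝ) ^ M * ((2 : ℝ) ^ k * z + a / 2 ^ n) =
      ((2 : ℝ) ^ L * z + ((a * 2 ^ t : ℤ) : ℝ)) / ((2 ^ r : ℕ) : ℝ) := by
    intro z
    have e1 : (2 : ℝ) ^ r * 2 ^ M * (2 : ℝ) ^ k = 2 ^ L := by
      rw [← zpow_natCast, ← zpow_natCast, ← zpow_natCast, ← zpow_add₀ h2, ← zpow_add₀ h2]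
      congr 1; omega
    have e2 : (2 : ℝ) ^ r * 2 ^ M = 2 ^ t * 2 ^ n := by
      rw [← pow_add, ← pow_add]
      congr 1; omega
    push_cast
    rw [eq_div_iff (by positivity)]
    field_simp
    linear_combination (2 ^ n * z) * e1 + a * e2
  rw [key, key, Int.floor_div_natCast, Int.floor_div_natCast, Int.floor_add_intCast,
    Int.floor_add_intCast, hxy]

theorem isDyadicPL_iff {s : Set ℝ} (f : s → s) :
    IsDyadicPL f ↔ ∃ N : ℕ, ∀ j : ℤ, ∃ (k : ℤ) (c : ℝ), IsDyadic c ∧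
      ∀ x : s, ⌊(2 : ℝ) ^ N * (x : ℝ)⌋ = j → (f x : ℝ) = (2 : ℝ) ^ k * (x : ℝ) + c := by
  simp only [IsDyadicPL, Int.floor_eq_iff, and_imp]

theorem IsDyadicPL.comp {s : Set ℝ} (hs : s ⊆ Set.Icc 0 1) {g f : s → s}
    (hg : IsDyadicPL g) (hf : IsDyadicPL f) : IsDyadicPL (g ∘ f) := by
  rw [isDyadicPL_iff] at *
  obtain ⟨M, hM⟩ := hg
  obtain ⟨N, hN⟩ := hf
  choose k c hc hf using hN
  choose R hR using fun j => (hc j).cell (k j) M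
  have h0 : IsDyadic 0 := ⟨0, 0, by simp⟩
  obtain ⟨R₀, hR₀⟩ := h0.cell 0 N
  let L := R₀ + (Finset.Icc (0 : ℤ) (2 ^ N)).sup R
  have hLj : ∀ x : s, R ⌊(2 : ℝ) ^ N * (x : ℝ)⌋ ≤ L := by
    intro x
    have hx := hs x.2
    have h := Finset.le_sup (f := R) (b := ⌊(2 : ℝ) ^ N * (x : ℝ)⌋)
      (s := Finset.Icc (0 : ℤ) (2 ^ N)) (by
        rw [Finset.mem_Icc]
        refine ⟨Int.floor_nonneg.2 (by have := hx.1; positivity), Int.floor_le_iff.2 ?_⟩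
        push_cast
        have : (0 : ℝ) < 2 ^ N := by positivity
        nlinarith [hx.2])
    omega
  refine ⟨L, fun i => ?_⟩
  by_cases hi : ∃ x₀ : s, ⌊(2 : ℝ) ^ L * (x₀ : ℝ)⌋ = i
  · obtain ⟨x₀, rfl⟩ := hi
    obtain ⟨k', c', hc', hg'⟩ := hM ⌊(2 : ℝ) ^ M * (f x₀ : ℝ)⌋
    set j := ⌊(2 : ℝ) ^ N * (x₀ : ℝ)⌋ with hj
    refine ⟨k' + k j, 2 ^ k' * c j + c', ((hc j).zpow_mul k').add hc', fun x hx => ?_⟩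
    have hxj : ⌊(2 : ℝ) ^ N * (x : ℝ)⌋ = j := by
      simpa using hR₀ L (by omega) x x₀ hx
    have h1 := hf j x hxj
    have h2 := hf j x₀ rfl
    have h3 := hR j L (hLj x₀) x x₀ hx
    rw [← h1, ← h2] at h3
    rw [Function.comp_apply, hg' (f x) h3, h1, zpow_add₀ two_ne_zero]
    ring
  · exact ⟨0, 0, h0, fun x hx => (hi ⟨x, hx⟩).elim⟩

theorem IsDyadicPL.symm {s : Set ℝ} (hs₀ : Set.Ico 0 1 ⊆ s) (hs : s ⊆ Set.Icc 0 1)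
    {f : Equiv.Perm s} (hf : IsDyadicPL f) : IsDyadicPL f.symm := by
  rw [isDyadicPL_iff] at *
  obtain ⟨N, hN⟩ := hf
  choose k c hc hf using hN
  have hc' : ∀ j, IsDyadic (-(2 ^ (-k j) * c j)) := fun j => ((hc j).zpow_mul _).neg
  choose R hR using fun j => (hc' j).cell (-k j) N
  let L := (Finset.Icc (0 : ℤ) (2 ^ N)).sup R
  have hL : ∀ j ∈ Finset.Icc (0 : ℤ) (2 ^ N), R j ≤ L := fun j hj => Finset.le_sup hj
  have inv : ∀ j (x y : ℝ), y = 2 ^ k j * x + c j ↔ x = 2 ^ (-k j) * y + -(2 ^ (-k j) * c j) := by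
    intro j x y
    have : (2 : ℝ) ^ k j ≠ 0 := by positivity
    rw [zpow_neg]
    constructor
    · rintro rfl; field_simp; ring
    · rintro rfl; field_simp; ring
  refine ⟨L, fun i => ?_⟩
  by_cases hi : ∃ y₀ : s, ⌊(2 : ℝ) ^ L * (y₀ : ℝ)⌋ = i ∧ (f.symm y₀ : ℝ) < 1
  · obtain ⟨y₀, rfl, hy₀⟩ := hi
    set x₀ := f.symm y₀ with hx₀
    set j := ⌊(2 : ℝ) ^ N * (x₀ : ℝ)⌋ with hj
    have hfx₀ : f x₀ = y₀ := by simp [hx₀]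
    have hx00 : (0 : ℝ) ≤ x₀ := (hs x₀.2).1
    have hN0 : (0 : ℝ) < 2 ^ N := by positivity
    have hj0 : 0 ≤ j := Int.floor_nonneg.2 (by positivity)
    have hj1 : j < 2 ^ N := by
      rw [hj, Int.floor_lt]
      push_cast
      nlinarith
    refine ⟨-k j, _, hc' j, fun y hy => ?_⟩
    have h1 := (inv j _ _).1 (hf j x₀ rfl)
    rw [hfx₀] at h1
    have h2 := hR j L (hL j (Finset.mem_Icc.2 ⟨hj0, hj1.le⟩)) y y₀ hy
    rw [← h1, ← hj] at h2
    set x := (2 : ℝ) ^ (-k j) * (y : ℝ) + -(2 ^ (-k j) * c j) with hx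
    have hxs : x ∈ s := by
      apply hs₀
      rw [Int.floor_eq_iff] at h2
      have a0 : (0 : ℝ) ≤ j := by exact_mod_cast hj0
      have a1 : (j : ℝ) + 1 ≤ 2 ^ N := by exact_mod_cast hj1
      constructor
      · by_contra! hneg
        nlinarith
      · by_contra! hneg
        nlinarith
    have h3 : f ⟨x, hxs⟩ = y := by
      apply Subtype.ext
      rw [hf j ⟨x, hxs⟩ h2]
      exact ((inv j _ _).2 hx).symm
    rw [← h3]
    simp
  · push Not at hi
    refine ⟨-k (2 ^ N), _, hc' (2 ^ N), fun y hy => ?_⟩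
    have h1 : (f.symm y : ℝ) = 1 := le_antisymm (hs (f.symm y).2).2 (hi y hy)
    have h2 := hf (2 ^ N) (f.symm y) (by
      rw [h1, mul_one]
      exact_mod_cast Int.floor_intCast (R := ℝ) (2 ^ N))
    rw [Equiv.apply_symm_apply] at h2
    exact (inv _ _ _).1 h2

/-- For `s` equal to `[0, 1)` or `[0, 1]`: the group of all dyadic piecewise linear bijections
of `s`. -/
def dyadicPLGroup (s : Set ℝ) (hs₀ : Set.Ico 0 1 ⊆ s) (hs : s ⊆ Set.Icc 0 1) :
    Subgroup (Equiv.Perm s) where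
  carrier := {f | IsDyadicPL f}
  one_mem' := ⟨0, fun _ => ⟨0, 0, ⟨0, 0, by simp⟩, fun x _ _ => by simp⟩⟩
  mul_mem' {f g} hf hg := IsDyadicPL.comp (g := f) (f := g) hs hf hg
  inv_mem' hf := IsDyadicPL.symm hs₀ hs hf

/-! ## Thompson's groups -/

/-- A homeomorphism, regarded as a permutation. -/
def homeoToPerm (X : Type*) [TopologicalSpace X] : (X ≃ₜ X) →* Equiv.Perm X where
  toFun h := h.toEquiv
  map_one' := rfl
  map_mul' _ _ := rfl

/-- The circle `ℝ / ℤ`, identified with `[0, 1)`. -/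
noncomputable def circleEquivIco : UnitAddCircle ≃ Set.Ico (0 : ℝ) 1 :=
  (AddCircle.equivIco (1 : ℝ) 0).trans (Equiv.setCongr (by rw [zero_add]))

/-- Thompson's group `V`: the right-continuous dyadic piecewise linear bijections of `[0, 1)`. -/
def thompsonV : Subgroup (Equiv.Perm (Set.Ico (0 : ℝ) 1)) :=
  dyadicPLGroup (Set.Ico 0 1) subset_rfl Set.Ico_subset_Icc_self

/-- Thompson's group `T`: the dyadic piecewise linear homeomorphisms of the circle. -/
noncomputable def thompsonT : Subgroup (UnitAddCircle ≃ₜ UnitAddCircle) :=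
  thompsonV.comap (circleEquivIco.permCongrHom.toMonoidHom.comp (homeoToPerm UnitAddCircle))

/-- Thompson's group `F`: the dyadic piecewise linear homeomorphisms of `[0, 1]`. -/
def thompsonF : Subgroup (unitInterval ≃ₜ unitInterval) :=
  (dyadicPLGroup (Set.Icc 0 1) Set.Ico_subset_Icc_self subset_rfl).comap
    (homeoToPerm unitInterval)

/-- `F_S`: the elements of `F` that are the identity on `S ⊆ [0, 1]`. -/
def thompsonFFix (S : Set ℝ) : Subgroup thompsonF where
  carrier := {g | ∀ x : unitInterval, (x : ℝ) ∈ S → g.1 x = x}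
  one_mem' _ _ := rfl
  mul_mem' {a _} ha hb x hx := (congrArg a.1 (hb x hx)).trans (ha x hx)
  inv_mem' {a} ha x hx := a.1.symm_apply_eq.2 (ha x hx).symm

/-- `T_S`: the elements of `T` that are the identity on the image of `S ⊆ ℝ` in the circle
`ℝ / ℤ`. -/
def thompsonTFix (S : Set ℝ) : Subgroup thompsonT where
  carrier := {g | ∀ x : ℝ, x ∈ S → g.1 (x : UnitAddCircle) = (x : UnitAddCircle)}
  one_mem' _ _ := rfl
  mul_mem' {a _} ha hb x hx := (congrArg a.1 (hb x hx)).trans (ha x hx)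
  inv_mem' {a} ha x hx := a.1.symm_apply_eq.2 (ha x hx).symm

/-- `V_S`: the elements of `V` that are the identity on `S ⊆ [0, 1)`. -/
def thompsonVFix (S : Set ℝ) : Subgroup thompsonV where
  carrier := {g | ∀ x : Set.Ico (0 : ℝ) 1, (x : ℝ) ∈ S → g.1 x = x}
  one_mem' _ _ := rfl
  mul_mem' {a _} ha hb x hx := (congrArg a.1 (hb x hx)).trans (ha x hx)
  inv_mem' {a} ha x hx := a.1.symm_apply_eq.2 (ha x hx).symm

/-! Each of the three groups acts faithfully on `[0, 1)` through `V`, and its image contains every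
increasing element of `V`. A coset `H g` of the stabilizer `H` of `[0, 1/2)` amounts to the
restriction of `g⁻¹` to `[0, 1/2)`. Let `A` be the set of cosets for which this restriction is
affine onto a standard dyadic interval `J`; then `J` determines the coset. Right multiplication by
`s` replaces `g⁻¹` by `s⁻¹ g⁻¹`, and `s⁻¹` is affine on all sufficiently short standard dyadic
intervals, so only finitely many `J` lead out of `A` (`affineCosets_almost_invariant`). The set `A`
is infinite because powers of `thompsonX⁻¹` shrink `[0, 1/2)` affinely.

An element `b` preserving `[0, 1/2)` normalizes `H`, so `b A` has the same properties. For `b` a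
power of `quarterX`, which fixes `0` and is supported in `[1/4, 1/2)`, these translates are pairwise
disjoint (`affineCosets_disjoint`): affine maps that agree at `0` and `1/4` agree on `[0, 1/2)`.
Infinitely many disjoint infinite almost invariant sets give infinitely many ends
(`numEnds_cosetGraph_eq_top`).

Finite generation rests on a normal form for dyadic partitions. An element of `V` carries a uniform
dyadic partition to another dyadic partition. If a subgroup can move both onto the same comb
`dyadicVine` with matching labels, it contains that element. Tree rotations, which are copies of
`thompsonX`, suffice for ordered partitions and hence for `F`. For `V`, adjacent transpositions of
the comb are added. For `T`, the half turn allows the image of `0` to be moved back to `0`, which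
reduces to `F`. -/

/-! ## A criterion for a coset graph to have infinitely many ends -/

section CosetGraph

variable {G : Type*} [Group G] (H : Subgroup G)

/-- The right coset `H g`. -/
def rightCosetMk (g : G) : Quotient (QuotientGroup.rightRel H) :=
  Quotient.mk (QuotientGroup.rightRel H) g

theorem rightCosetMk_eq {H : Subgroup G} {g h : G} :
    rightCosetMk H g = rightCosetMk H h ↔ h * g⁻¹ ∈ H :=
  Quotient.eq.trans (by rw [QuotientGroup.rightRel_apply])

theorem rightCosetMk_mul_right {H : Subgroup G} {g h : G}
    (e : rightCosetMk H g = rightCosetMk H h) (s : G) :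
    rightCosetMk H (g * s) = rightCosetMk H (h * s) := by
  rw [rightCosetMk_eq] at *
  simpa [mul_assoc] using e

theorem exists_rightCosetMk (q : Quotient (QuotientGroup.rightRel H)) :
    ∃ g, rightCosetMk H g = q :=
  Quotient.exists_rep q

/-- An edge comes with its own representative, but right multiplication is well defined on right
cosets, so any representative `g` of `u` serves. Reading the edge backwards accounts for `s⁻¹ ∈ S`.
-/
theorem cosetGraph_adj_cases {S : Set G} {u v : Quotient (QuotientGroup.rightRel H)}
    (h : (cosetGraph H S).Adj u v) {g : G} (hg : u = rightCosetMk H g) :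
    ∃ s : G, (s ∈ S ∨ s⁻¹ ∈ S) ∧ v = rightCosetMk H (g * s) := by
  obtain ⟨-, ⟨a, s, hs, ha, hv⟩ | ⟨a, s, hs, ha, hv⟩⟩ := h
  · exact ⟨s, .inl hs, hv.trans (rightCosetMk_mul_right (ha.symm.trans hg) s)⟩
  · refine ⟨s⁻¹, .inr (by simpa), ha.trans ?_⟩
    have := rightCosetMk_mul_right (hv.symm.trans hg) s⁻¹
    rwa [mul_inv_cancel_right] at this

theorem cosetGraph_reachable_mul {S : Set G} (g : G) {s : G} (hs : s ∈ S) :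
    (cosetGraph H S).Reachable (rightCosetMk H g) (rightCosetMk H (g * s)) := by
  by_cases h : rightCosetMk H g = rightCosetMk H (g * s)
  · rw [← h]
  · exact SimpleGraph.Adj.reachable ⟨h, .inl ⟨g, s, hs, rfl, rfl⟩⟩

theorem cosetGraph_preconnected {S : Set G} (hS : Subgroup.closure S = ⊤) :
    (cosetGraph H S).Preconnected := by
  have key : ∀ g : G, (cosetGraph H S).Reachable (rightCosetMk H 1) (rightCosetMk H g) := by
    intro g
    have hg : g ∈ Subgroup.closure S := hS ▸ Subgroup.mem_top g
    induction hg using Subgroup.closure_induction_right with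
    | one => rfl
    | mul_right x _ y hy ih => exact ih.trans (cosetGraph_reachable_mul H x hy)
    | mul_inv_cancel x _ y hy ih =>
      refine ih.trans ?_
      have := (cosetGraph_reachable_mul H (x * y⁻¹) hy).symm
      rwa [inv_mul_cancel_right] at this
  intro u v
  obtain ⟨g, rfl⟩ := exists_rightCosetMk H u
  obtain ⟨h, rfl⟩ := exists_rightCosetMk H v
  exact (key g).symm.trans (key h)

theorem cosetGraph_finite_neighborSet (S : Finset G) (u : Quotient (QuotientGroup.rightRel H)) :
    ((cosetGraph H (S : Set G)).neighborSet u).Finite := by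
  obtain ⟨g, rfl⟩ := exists_rightCosetMk H u
  refine ((S.finite_toSet.union S.finite_toSet.inv).image fun s => rightCosetMk H (g * s)).subset ?_
  intro v hv
  obtain ⟨s, hs, rfl⟩ := cosetGraph_adj_cases H hv rfl
  exact ⟨s, by simpa using hs, rfl⟩

/-- The coset graph has infinitely many ends as soon as there are infinitely many pairwise
disjoint infinite sets of cosets that are almost invariant under right multiplication. -/
theorem numEnds_cosetGraph_eq_top (S : Finset G) (hS : Subgroup.closure (S : Set G) = ⊤)
    (A : ℕ → Set (Quotient (QuotientGroup.rightRel H)))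
    (hdisj : ∀ i j, i ≠ j → Disjoint (A i) (A j)) (hinf : ∀ i, (A i).Infinite)
    (hfin : ∀ i, ∀ s : G,
      {q | ∃ g, q = rightCosetMk H g ∧ q ∈ A i ∧ rightCosetMk H (g * s) ∉ A i}.Finite) :
    numEnds (cosetGraph H (S : Set G)) = ⊤ := by
  classical
  set Γ := cosetGraph H (S : Set G) with hΓ
  -- Connectedness and local finiteness make the set of components of the complement of a finite set
  -- finite; the covering argument for `hex` needs this.
  have : Fact Γ.Preconnected := ⟨cosetGraph_preconnected H hS⟩
  have : Γ.LocallyFinite := fun u => (cosetGraph_finite_neighborSet H S u).fintype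
  refine ENat.eq_top_iff_forall_ge.2 fun n => ?_
  -- The inner vertex boundaries of `A 0, …, A (n - 1)`. Once they are removed, no path can leave
  -- any of these sets.
  let B : Set (Quotient (QuotientGroup.rightRel H)) :=
    ⋃ i ∈ Finset.range n, ⋃ s ∈ (S : Set G) ∪ (S : Set G)⁻¹,
      {q | ∃ g, q = rightCosetMk H g ∧ q ∈ A i ∧ rightCosetMk H (g * s) ∉ A i}
  have hB : B.Finite := by
    refine (Finset.range n).finite_toSet.biUnion fun i _ => ?_
    exact (S.finite_toSet.union S.finite_toSet.inv).biUnion fun s _ => hfin i s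
  let K : Finset (Quotient (QuotientGroup.rightRel H)) := hB.toFinset
  have hstep : ∀ i < n, ∀ u v, u ∉ (K : Set _) → u ∈ A i → Γ.Adj u v → v ∈ A i := by
    intro i hi u v huK hu huv
    obtain ⟨g, rfl⟩ := exists_rightCosetMk H u
    obtain ⟨s, hs, rfl⟩ := cosetGraph_adj_cases H huv rfl
    by_contra hv
    refine huK ?_
    simp only [K, Set.Finite.coe_toFinset, B, Set.mem_iUnion]
    exact ⟨i, Finset.mem_range.2 hi, s, by simpa using hs, g, rfl, hu, hv⟩
  have hsat : ∀ i < n, ∀ C : Γ.ComponentCompl (K : Set _), ∀ u ∈ C.supp, u ∈ A i → C.supp ⊆ A i := by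
    rintro i hi C u ⟨huK, rfl⟩ hu v ⟨hvK, hv⟩
    obtain ⟨p⟩ := SimpleGraph.ConnectedComponent.exact hv.symm
    suffices ∀ a b : ((K : Set (Quotient (QuotientGroup.rightRel H)))ᶜ : Set _),
        (Γ.induce _).Walk a b → a.1 ∈ A i → b.1 ∈ A i from this _ _ p hu
    intro a b p
    induction p with
    | nil => exact id
    | @cons a b c h p ih => exact fun ha => ih (hstep i hi a b a.2 ha h)
  have hex : ∀ i : Fin n, ∃ C : Γ.ComponentCompl (K : Set _), C.supp.Infinite ∧ C.supp ⊆ A i := by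
    intro i
    by_contra! hcon
    -- Finitely many components cover the infinite set `A i \ K`, so they cannot all be finite.
    have hcov : A i \ K ⊆ ⋃ C : {C : Γ.ComponentCompl (K : Set _) // C.supp ⊆ A i}, C.1.supp := by
      rintro u ⟨hu, huK⟩
      exact Set.mem_iUnion.2
        ⟨⟨Γ.componentComplMk huK, hsat i i.2 _ u ⟨huK, rfl⟩ hu⟩, huK, rfl⟩
    refine ((hinf i).sdiff K.finite_toSet) (Set.Finite.subset (Set.finite_iUnion fun C => ?_) hcov)
    by_contra hC
    exact hcon C.1 hC C.2
  choose C hCinf hCsub using hex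
  have hinj : Function.Injective C := by
    intro i j hij
    by_contra hne
    obtain ⟨u, hu⟩ := (hCinf i).nonempty
    exact Set.disjoint_left.1 (hdisj i j fun h => hne (Fin.ext h)) (hCsub i hu)
      (hCsub j (hij ▸ hu))
  refine le_trans ?_ (le_iSup _ K)
  calc (n : ℕ∞) = (Set.range C).encard := by
        rw [← Set.image_univ, hinj.encard_image]; simp
    _ ≤ _ := Set.encard_le_encard (by rintro _ ⟨i, rfl⟩; exact hCinf i)

end CosetGraph

/-! ## Permutations of `[0, 1)` that are affine on standard dyadic intervals -/

/-- The point `x` of `[0, 1)` lies in the standard dyadic interval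
`[I.2 / 2 ^ I.1, (I.2 + 1) / 2 ^ I.1)`. -/
def MemDyadic (x : Set.Ico (0 : ℝ) 1) (I : ℕ × ℤ) : Prop :=
  (I.2 : ℝ) ≤ 2 ^ I.1 * (x : ℝ) ∧ 2 ^ I.1 * (x : ℝ) < I.2 + 1

/-- The standard dyadic interval `I` is contained in `[0, 1)`. -/
def DyadicValid (I : ℕ × ℤ) : Prop := 0 ≤ I.2 ∧ I.2 < 2 ^ I.1

/-- `g` maps the standard dyadic interval `I` onto `J` by an increasing affine map. -/
def MapsAffine (g : Equiv.Perm (Set.Ico (0 : ℝ) 1)) (I J : ℕ × ℤ) : Prop :=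
  ∀ x, MemDyadic x I → (2 : ℝ) ^ J.1 * (g x : ℝ) - J.2 = 2 ^ I.1 * (x : ℝ) - I.2

/-- The left half of a standard dyadic interval. -/
def dyadicLeft (I : ℕ × ℤ) : ℕ × ℤ := (I.1 + 1, 2 * I.2)

/-- The right half of a standard dyadic interval. -/
def dyadicRight (I : ℕ × ℤ) : ℕ × ℤ := (I.1 + 1, 2 * I.2 + 1)

theorem MemDyadic.valid {x : Set.Ico (0 : ℝ) 1} {I : ℕ × ℤ} (h : MemDyadic x I) :
    DyadicValid I := by
  obtain ⟨x, hx0, hx1⟩ := x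
  obtain ⟨h1, h2⟩ := h
  have hp : (0 : ℝ) < 2 ^ I.1 := by positivity
  simp only at h1 h2
  constructor
  · have : (-1 : ℝ) < I.2 := by nlinarith
    have : (-1 : ℤ) < I.2 := by exact_mod_cast this
    omega
  · have : (I.2 : ℝ) < 2 ^ I.1 := by nlinarith
    exact_mod_cast this

/-- The affine parametrization of a standard dyadic interval by `[0, 1)`. -/
noncomputable def dyadicCoord (I : ℕ × ℤ) (hI : DyadicValid I) :
    Set.Ico (0 : ℝ) 1 ≃ {x // MemDyadic x I} where
  toFun t := ⟨⟨(I.2 + (t : ℝ)) / 2 ^ I.1, by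
      have h0 : (0 : ℝ) ≤ I.2 := by exact_mod_cast hI.1
      have := t.2.1
      positivity, by
      have h1 : (I.2 : ℝ) + 1 ≤ 2 ^ I.1 := by exact_mod_cast hI.2
      rw [div_lt_one (by positivity)]
      linarith [t.2.2]⟩, by
      have := t.2.1
      have := t.2.2
      constructor <;> simp only [] <;> rw [mul_div_cancel₀ _ (by positivity)] <;> linarith⟩
  invFun x := ⟨2 ^ I.1 * (x.1 : ℝ) - I.2, by linarith [x.2.1], by linarith [x.2.2]⟩
  left_inv t := by
    apply Subtype.ext
    simp only []
    rw [mul_div_cancel₀ _ (by positivity)]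
    ring
  right_inv x := by
    apply Subtype.ext
    apply Subtype.ext
    simp only []
    rw [add_sub_cancel, mul_div_cancel_left₀ _ (by positivity)]

theorem two_pow_mul_dyadicCoord (I : ℕ × ℤ) (hI : DyadicValid I) (t : Set.Ico (0 : ℝ) 1) :
    (2 : ℝ) ^ I.1 * ((dyadicCoord I hI t).1 : ℝ) = I.2 + t := by
  simp only [dyadicCoord, Equiv.coe_fn_mk]
  rw [mul_div_cancel₀ _ (by positivity)]

theorem MemDyadic.exists_coord {x : Set.Ico (0 : ℝ) 1} {I : ℕ × ℤ} (h : MemDyadic x I)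
    (hI : DyadicValid I) : ∃ t, x = (dyadicCoord I hI t).1 :=
  ⟨(dyadicCoord I hI).symm ⟨x, h⟩, by rw [Equiv.apply_symm_apply]⟩

theorem eq_of_two_pow_mul_eq {x y : Set.Ico (0 : ℝ) 1} (n : ℕ)
    (h : (2 : ℝ) ^ n * (x : ℝ) = 2 ^ n * (y : ℝ)) : x = y :=
  Subtype.ext (mul_left_cancel₀ (by positivity) h)

theorem MemDyadic.unique {x : Set.Ico (0 : ℝ) 1} {n : ℕ} {a b : ℤ} (ha : MemDyadic x (n, a))
    (hb : MemDyadic x (n, b)) : a = b := by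
  exact (Int.floor_eq_iff.2 ⟨ha.1, ha.2⟩).symm.trans (Int.floor_eq_iff.2 ⟨hb.1, hb.2⟩)

theorem exists_memDyadic (x : Set.Ico (0 : ℝ) 1) (n : ℕ) : ∃ a : ℤ, MemDyadic x (n, a) :=
  ⟨⌊(2 : ℝ) ^ n * (x : ℝ)⌋, Int.floor_le _, Int.lt_floor_add_one _⟩

theorem MemDyadic.ancestor {x : Set.Ico (0 : ℝ) 1} {n k : ℕ} {a : ℤ}
    (h : MemDyadic x (n + k, a)) : MemDyadic x (n, a / 2 ^ k) := by
  have e : (a : ℝ) = ((a / 2 ^ k : ℤ) : ℝ) * 2 ^ k + ((a % 2 ^ k : ℤ) : ℝ) := by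
    exact_mod_cast (Int.ediv_mul_add_emod a (2 ^ k)).symm
  have r0 : (0 : ℝ) ≤ ((a % 2 ^ k : ℤ) : ℝ) := by
    exact_mod_cast Int.emod_nonneg a (by positivity)
  have r1 : ((a % 2 ^ k : ℤ) : ℝ) + 1 ≤ 2 ^ k := by
    exact_mod_cast Int.emod_lt_of_pos a (by positivity)
  have hk : (0 : ℝ) < 2 ^ k := by positivity
  obtain ⟨h1, h2⟩ := h
  simp only [pow_add] at h1 h2
  constructor
  · simp only
    by_contra! hc
    nlinarith
  · simp only
    by_contra! hc
    nlinarith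

theorem memDyadic_left_or_right {x : Set.Ico (0 : ℝ) 1} {I : ℕ × ℤ} (h : MemDyadic x I) :
    MemDyadic x (dyadicLeft I) ∨ MemDyadic x (dyadicRight I) := by
  obtain ⟨h1, h2⟩ := h
  simp only [MemDyadic, dyadicLeft, dyadicRight, pow_succ]
  push_cast
  by_cases hc : 2 ^ I.1 * (x : ℝ) * 2 < 2 * I.2 + 1
  · exact .inl ⟨by linarith, by linarith⟩
  · exact .inr ⟨by linarith, by linarith⟩

theorem MemDyadic.of_left {x : Set.Ico (0 : ℝ) 1} {I : ℕ × ℤ} (h : MemDyadic x (dyadicLeft I)) :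
    MemDyadic x I := by
  obtain ⟨h1, h2⟩ := h
  simp only [dyadicLeft, pow_succ] at h1 h2
  push_cast at h1 h2
  exact ⟨by linarith, by linarith⟩

theorem MemDyadic.of_right {x : Set.Ico (0 : ℝ) 1} {I : ℕ × ℤ}
    (h : MemDyadic x (dyadicRight I)) : MemDyadic x I := by
  obtain ⟨h1, h2⟩ := h
  simp only [dyadicRight, pow_succ] at h1 h2
  push_cast at h1 h2
  exact ⟨by linarith, by linarith⟩

namespace MapsAffine

variable {f g : Equiv.Perm (Set.Ico (0 : ℝ) 1)} {I J K : ℕ × ℤ}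

theorem one (I : ℕ × ℤ) : MapsAffine 1 I I := fun _ _ => rfl

theorem mem (h : MapsAffine g I J) {x : Set.Ico (0 : ℝ) 1} (hx : MemDyadic x I) :
    MemDyadic (g x) J := by
  have := h x hx
  exact ⟨by linarith [hx.1], by linarith [hx.2]⟩

theorem mul (hg : MapsAffine g J K) (hf : MapsAffine f I J) : MapsAffine (g * f) I K :=
  fun x hx => (hg _ (hf.mem hx)).trans (hf x hx)

theorem valid (h : MapsAffine g I J) (hI : DyadicValid I) : DyadicValid J :=
  (h.mem (dyadicCoord I hI ⟨0, by simp⟩).2).valid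

theorem apply_coord (h : MapsAffine g I J) (hI : DyadicValid I) (t : Set.Ico (0 : ℝ) 1) :
    g (dyadicCoord I hI t).1 = (dyadicCoord J (h.valid hI) t).1 := by
  apply eq_of_two_pow_mul_eq J.1
  have := h _ (dyadicCoord I hI t).2
  rw [two_pow_mul_dyadicCoord] at *
  linarith

theorem of_coord (hI : DyadicValid I) (hJ : DyadicValid J)
    (h : ∀ t, g (dyadicCoord I hI t).1 = (dyadicCoord J hJ t).1) : MapsAffine g I J := by
  intro x hx
  obtain ⟨t, rfl⟩ := hx.exists_coord hI
  rw [h, two_pow_mul_dyadicCoord, two_pow_mul_dyadicCoord]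
  ring

theorem inv (h : MapsAffine g I J) (hI : DyadicValid I) : MapsAffine g⁻¹ J I :=
  of_coord (h.valid hI) hI fun t => by rw [Equiv.Perm.inv_eq_iff_eq, h.apply_coord]

theorem mem_iff (h : MapsAffine g I J) (hI : DyadicValid I) {x : Set.Ico (0 : ℝ) 1} :
    MemDyadic (g x) J ↔ MemDyadic x I :=
  ⟨fun hx => by simpa using (h.inv hI).mem hx, h.mem⟩

theorem eq_of_mem (hf : MapsAffine f I J) (hg : MapsAffine g I J) {x : Set.Ico (0 : ℝ) 1}
    (hx : MemDyadic x I) : f x = g x :=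
  eq_of_two_pow_mul_eq J.1 (by linarith [hf x hx, hg x hx])

theorem left (h : MapsAffine g I J) : MapsAffine g (dyadicLeft I) (dyadicLeft J) := by
  intro x hx
  have := h x hx.of_left
  simp only [dyadicLeft, pow_succ]
  push_cast
  linarith

theorem right (h : MapsAffine g I J) : MapsAffine g (dyadicRight I) (dyadicRight J) := by
  intro x hx
  have := h x hx.of_right
  simp only [dyadicRight, pow_succ]
  push_cast
  linarith

/-- The hypothesis on `j` says that the interval `(I.1 + k, j)` lies inside `I`; `j % 2 ^ k` is its
position there, which an affine map preserves. -/
theorem descend (h : MapsAffine g I J) (k : ℕ) (j : ℤ) (hj : j / 2 ^ k = I.2) :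
    MapsAffine g (I.1 + k, j) (J.1 + k, J.2 * 2 ^ k + j % 2 ^ k) := by
  intro x hx
  have hx' := hx.ancestor
  rw [hj] at hx'
  have := h x hx'
  have e : (j : ℝ) = (I.2 : ℝ) * 2 ^ k + ((j % 2 ^ k : ℤ) : ℝ) := by
    rw [← hj]
    exact_mod_cast (Int.ediv_mul_add_emod j (2 ^ k)).symm
  simp only [pow_add]
  push_cast at e ⊢
  rw [e]
  linear_combination (2 : ℝ) ^ k * this

end MapsAffine

/-! ### Elements of `V` as maps affine on the dyadic intervals of one level -/

/-- `g` maps each standard dyadic interval of length `2 ^ (-L)` affinely onto a standard dyadic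
interval. -/
def AffineAtLevel (g : Equiv.Perm (Set.Ico (0 : ℝ) 1)) (L : ℕ) : Prop :=
  ∀ j : ℤ, ∃ J, MapsAffine g (L, j) J

theorem AffineAtLevel.mono {g : Equiv.Perm (Set.Ico (0 : ℝ) 1)} {L M : ℕ}
    (h : AffineAtLevel g L) (hLM : L ≤ M) : AffineAtLevel g M := by
  obtain ⟨k, rfl⟩ := Nat.exists_eq_add_of_le hLM
  intro j
  obtain ⟨J, hJ⟩ := h (j / 2 ^ k)
  exact ⟨_, hJ.descend k j rfl⟩

theorem mem_thompsonV_iff {g : Equiv.Perm (Set.Ico (0 : ℝ) 1)} :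
    g ∈ thompsonV ↔ ∃ L, AffineAtLevel g L := by
  constructor
  · rintro ⟨N, hN⟩
    choose k c hc hg using hN
    choose a n hcn using hc
    -- Fine enough that, on every cell, the image level `m = L - k j` is at least the exponent `n j`
    -- of the denominator of `c j`; the image of a cell is then again a standard dyadic interval.
    let L := N + (Finset.Ico (0 : ℤ) (2 ^ N)).sup fun j => n j + (k j).natAbs
    refine ⟨L, fun i => ?_⟩
    by_cases hi : ∃ x, MemDyadic x (L, i)
    · obtain ⟨x₀, hx₀⟩ := hi
      set d := (Finset.Ico (0 : ℤ) (2 ^ N)).sup fun j => n j + (k j).natAbs with hd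
      set j := i / 2 ^ d with hj
      have hx₀' : MemDyadic x₀ (N, j) := hx₀.ancestor
      have hjd : n j + (k j).natAbs ≤ d :=
        Finset.le_sup (f := fun j => n j + (k j).natAbs) (Finset.mem_Ico.2 hx₀'.valid)
      obtain ⟨m, hm⟩ : ∃ m : ℕ, (m : ℤ) = L - k j := ⟨(L - k j : ℤ).toNat, by omega⟩
      obtain ⟨r, hr⟩ : ∃ r : ℕ, m = r + n j := ⟨m - n j, by omega⟩
      refine ⟨(m, i + a j * 2 ^ r), fun x hx => ?_⟩
      have hx' : MemDyadic x (N, j) := hx.ancestor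
      have e : (2 : ℝ) ^ m * 2 ^ k j = 2 ^ L := by
        rw [← zpow_natCast, ← zpow_natCast, ← zpow_add₀ two_ne_zero, hm, sub_add_cancel]
      have e2 : (2 : ℝ) ^ m * (a j / 2 ^ n j) = a j * 2 ^ r := by
        rw [hr, pow_add]
        field_simp
      simp only
      rw [hg j x hx'.1 hx'.2, hcn, mul_add, e2, ← mul_assoc, e]
      push_cast
      ring
    · exact ⟨(0, 0), fun x hx => (hi ⟨x, hx⟩).elim⟩
  · rintro ⟨L, hL⟩
    refine ⟨L, fun j => ?_⟩
    obtain ⟨⟨m, b⟩, h⟩ := hL j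
    refine ⟨L - m, (b - j : ℤ) / 2 ^ m, ⟨b - j, m, rfl⟩, fun x h1 h2 => ?_⟩
    have := h x ⟨h1, h2⟩
    simp only at this
    rw [zpow_sub₀ two_ne_zero, zpow_natCast, zpow_natCast]
    field_simp
    push_cast
    linarith

/-! ### Rescaled copies -/

open Classical in
/-- The permutation acting on the standard dyadic interval `I` as a rescaled copy of `f`, and as
the identity elsewhere. -/
noncomputable def dyadicCopy (I : ℕ × ℤ) (hI : DyadicValid I)
    (f : Equiv.Perm (Set.Ico (0 : ℝ) 1)) : Equiv.Perm (Set.Ico (0 : ℝ) 1) :=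
  f.extendDomain (dyadicCoord I hI)

section Copy

variable {I J : ℕ × ℤ} {hI : DyadicValid I} {f g : Equiv.Perm (Set.Ico (0 : ℝ) 1)}

open scoped Classical in
theorem dyadicCopy_coord (t : Set.Ico (0 : ℝ) 1) :
    dyadicCopy I hI f (dyadicCoord I hI t).1 = (dyadicCoord I hI (f t)).1 :=
  Equiv.Perm.extendDomain_apply_image _ _ _

open scoped Classical in
theorem dyadicCopy_of_notMem {x : Set.Ico (0 : ℝ) 1} (hx : ¬ MemDyadic x I) :
    dyadicCopy I hI f x = x :=
  Equiv.Perm.extendDomain_apply_not_subtype _ _ hx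

theorem dyadicCopy_memDyadic_iff {x : Set.Ico (0 : ℝ) 1} :
    MemDyadic (dyadicCopy I hI f x) I ↔ MemDyadic x I := by
  by_cases hx : MemDyadic x I
  · obtain ⟨t, rfl⟩ := hx.exists_coord hI
    rw [dyadicCopy_coord]
    exact iff_of_true (dyadicCoord I hI _).2 hx
  · rw [dyadicCopy_of_notMem hx]

open scoped Classical in
theorem dyadicCopy_pow (n : ℕ) : dyadicCopy I hI f ^ n = dyadicCopy I hI (f ^ n) :=
  (Equiv.Perm.extendDomain_pow _ _ _).symm

/-- An affine `g : I → J` intertwines the parametrizations of `I` and `J`, whatever it does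
elsewhere. This is how a few generators yield copies on infinitely many intervals. -/
theorem MapsAffine.conj_dyadicCopy (h : MapsAffine g I J) :
    g * dyadicCopy I hI f * g⁻¹ = dyadicCopy J (h.valid hI) f := by
  rw [mul_inv_eq_iff_eq_mul]
  ext1 x
  simp only [Equiv.Perm.mul_apply]
  by_cases hx : MemDyadic x I
  · obtain ⟨t, rfl⟩ := hx.exists_coord hI
    rw [dyadicCopy_coord, h.apply_coord, h.apply_coord, dyadicCopy_coord]
  · rw [dyadicCopy_of_notMem hx, dyadicCopy_of_notMem fun hx' => hx ((h.mem_iff hI).1 hx')]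

theorem dyadicCopy_zero (f : Equiv.Perm (Set.Ico (0 : ℝ) 1)) (h : DyadicValid (0, 0)) :
    dyadicCopy (0, 0) h f = f := by
  have key : ∀ t, (dyadicCoord (0, 0) h t).1 = t := fun t =>
    Subtype.ext (by simpa using two_pow_mul_dyadicCoord (0, 0) h t)
  ext1 x
  have := dyadicCopy_coord (hI := h) (f := f) x
  rwa [key, key] at this

/-- The standard dyadic interval corresponding to `K` in the parametrization of `I`. -/
def dyadicSub (I K : ℕ × ℤ) : ℕ × ℤ := (I.1 + K.1, I.2 * 2 ^ K.1 + K.2)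

theorem MapsAffine.copy {K M : ℕ × ℤ} (h : MapsAffine f K M) (hK : DyadicValid K) :
    MapsAffine (dyadicCopy I hI f) (dyadicSub I K) (dyadicSub I M) := by
  intro x hx
  by_cases hx' : MemDyadic x I
  · obtain ⟨t, rfl⟩ := hx'.exists_coord hI
    have ht := two_pow_mul_dyadicCoord I hI t
    have hft := two_pow_mul_dyadicCoord I hI (f t)
    rw [dyadicCopy_coord]
    have hK : (0 : ℝ) < 2 ^ K.1 := by positivity
    obtain ⟨h1, h2⟩ := hx
    simp only [dyadicSub, pow_add] at h1 h2 ⊢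
    push_cast at h1 h2 ⊢
    have e : (2 : ℝ) ^ I.1 * 2 ^ K.1 * ((dyadicCoord I hI t).1 : ℝ) = 2 ^ K.1 * (I.2 + t) := by
      rw [← ht]; ring
    have e' : (2 : ℝ) ^ I.1 * 2 ^ M.1 * ((dyadicCoord I hI (f t)).1 : ℝ) =
        2 ^ M.1 * (I.2 + f t) := by
      rw [← hft]; ring
    have := h t ⟨by linarith, by linarith⟩
    rw [e, e']
    linarith
  · exfalso
    apply hx'
    have h0 : (0 : ℝ) ≤ K.2 := by exact_mod_cast hK.1
    have h1 : (K.2 : ℝ) + 1 ≤ 2 ^ K.1 := by exact_mod_cast hK.2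
    have hp : (0 : ℝ) < 2 ^ K.1 := by positivity
    obtain ⟨h2, h3⟩ := hx
    simp only [dyadicSub, pow_add] at h2 h3
    push_cast at h2 h3
    constructor
    · by_contra! hc
      nlinarith
    · by_contra! hc
      nlinarith

theorem AffineAtLevel.copy {L : ℕ} (h : AffineAtLevel f L) :
    AffineAtLevel (dyadicCopy I hI f) (I.1 + L) := by
  intro j
  by_cases hj : j / 2 ^ L = I.2
  · obtain ⟨J, hJ⟩ := h (j % 2 ^ L)
    have := hJ.copy (hI := hI) ⟨Int.emod_nonneg _ (by positivity),
      Int.emod_lt_of_pos _ (by positivity)⟩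
    simp only [dyadicSub, ← hj, Int.ediv_mul_add_emod] at this
    exact ⟨_, this⟩
  · refine ⟨(I.1 + L, j), fun x hx => ?_⟩
    rw [dyadicCopy_of_notMem]
    exact fun hx' => hj (hx.ancestor.unique hx')

theorem dyadicCopy_mem_thompsonV (hf : f ∈ thompsonV) : dyadicCopy I hI f ∈ thompsonV := by
  rw [mem_thompsonV_iff] at *
  obtain ⟨L, hL⟩ := hf
  exact ⟨_, hL.copy⟩

theorem dyadicCopy_strictMono (hf : StrictMono f) : StrictMono (dyadicCopy I hI f) := by
  have hp : (0 : ℝ) < 2 ^ I.1 := by positivity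
  intro x y hxy
  have hxy' : (2 : ℝ) ^ I.1 * (x : ℝ) < 2 ^ I.1 * y := mul_lt_mul_of_pos_left hxy hp
  suffices (2 : ℝ) ^ I.1 * (dyadicCopy I hI f x : ℝ) < 2 ^ I.1 * dyadicCopy I hI f y from
    (mul_lt_mul_iff_right₀ hp).1 this
  by_cases hx : MemDyadic x I <;> by_cases hy : MemDyadic y I
  · obtain ⟨t, rfl⟩ := hx.exists_coord hI
    obtain ⟨u, rfl⟩ := hy.exists_coord hI
    rw [two_pow_mul_dyadicCoord, two_pow_mul_dyadicCoord] at hxy'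
    rw [dyadicCopy_coord, dyadicCopy_coord, two_pow_mul_dyadicCoord, two_pow_mul_dyadicCoord]
    have : t < u := Subtype.coe_lt_coe.1 (by linarith)
    have : (f t : ℝ) < f u := hf this
    linarith
  · have hx' := dyadicCopy_memDyadic_iff (hI := hI) (f := f) |>.2 hx
    rw [dyadicCopy_of_notMem hy]
    by_contra! hc
    exact hy ⟨by linarith [hx.1], by linarith [hx'.2]⟩
  · have hy' := dyadicCopy_memDyadic_iff (hI := hI) (f := f) |>.2 hy
    rw [dyadicCopy_of_notMem hx]
    by_contra! hc
    exact hx ⟨by linarith [hy'.1], by linarith [hy.2]⟩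
  · rwa [dyadicCopy_of_notMem hx, dyadicCopy_of_notMem hy]

end Copy

/-! ## Increasing elements of `V` -/

/-- The standard element of infinite order of Thompson's group `F`. -/
noncomputable def thompsonX : Equiv.Perm (Set.Ico (0 : ℝ) 1) where
  toFun x := ⟨if (x : ℝ) < 1 / 4 then 2 * x else if (x : ℝ) < 1 / 2 then x + 1 / 4 else (x + 1) / 2,
    by have := x.2.1; have := x.2.2; constructor <;> split_ifs <;> linarith⟩
  invFun x := ⟨if (x : ℝ) < 1 / 2 then x / 2 else if (x : ℝ) < 3 / 4 then x - 1 / 4 else 2 * x - 1,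
    by have := x.2.1; have := x.2.2; constructor <;> split_ifs <;> linarith⟩
  left_inv x := by
    apply Subtype.ext
    simp only
    split_ifs <;> linarith
  right_inv x := by
    apply Subtype.ext
    simp only
    split_ifs <;> linarith

theorem thompsonX_apply (x : Set.Ico (0 : ℝ) 1) : (thompsonX x : ℝ) =
    if (x : ℝ) < 1 / 4 then 2 * (x : ℝ) else
      if (x : ℝ) < 1 / 2 then (x : ℝ) + 1 / 4 else ((x : ℝ) + 1) / 2 := rfl

theorem thompsonX_strictMono : StrictMono thompsonX := by
  intro x y hxy
  have : (x : ℝ) < y := hxy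
  rw [← Subtype.coe_lt_coe, thompsonX_apply, thompsonX_apply]
  split_ifs <;> linarith

theorem thompsonX_maps_left : MapsAffine thompsonX (2, 0) (1, 0) := by
  rintro x ⟨h1, h2⟩
  norm_num at h1 h2 ⊢
  rw [thompsonX_apply]
  split_ifs <;> linarith

theorem thompsonX_maps_mid : MapsAffine thompsonX (2, 1) (2, 2) := by
  rintro x ⟨h1, h2⟩
  norm_num at h1 h2 ⊢
  rw [thompsonX_apply]
  split_ifs <;> linarith

theorem thompsonX_maps_right : MapsAffine thompsonX (1, 1) (2, 3) := by
  rintro x ⟨h1, h2⟩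
  norm_num at h1 h2 ⊢
  rw [thompsonX_apply]
  split_ifs <;> linarith

theorem MapsAffine.of_not_valid {g : Equiv.Perm (Set.Ico (0 : ℝ) 1)} {I : ℕ × ℤ}
    (h : ¬ DyadicValid I) (J : ℕ × ℤ) : MapsAffine g I J := fun _ hx => (h hx.valid).elim

theorem thompsonX_mem_thompsonV : thompsonX ∈ thompsonV := by
  rw [mem_thompsonV_iff]
  refine ⟨2, fun j => ?_⟩
  by_cases hj : DyadicValid (2, j)
  · obtain ⟨h0, h1⟩ := hj
    simp only at h0 h1
    norm_num at h1
    interval_cases j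
    · exact ⟨_, thompsonX_maps_left⟩
    · exact ⟨_, thompsonX_maps_mid⟩
    · exact ⟨_, thompsonX_maps_right.left⟩
    · exact ⟨_, thompsonX_maps_right.right⟩
  · exact ⟨(0, 0), .of_not_valid hj _⟩

/-! ### Tails, the comb partition, and copies acting on tails -/

/-- The interval `[1 - 2 ^ (-i), 1)`. -/
def dyadicTail (i : ℕ) : ℕ × ℤ := (i, 2 ^ i - 1)

theorem dyadicTail_valid (i : ℕ) : DyadicValid (dyadicTail i) := by
  have : (1 : ℤ) ≤ 2 ^ i := one_le_pow₀ (by norm_num)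
  constructor <;> simp only [dyadicTail] <;> linarith

theorem dyadicRight_tail (i : ℕ) : dyadicRight (dyadicTail i) = dyadicTail (i + 1) := by
  ext
  · rfl
  · simp only [dyadicRight, dyadicTail, pow_succ]
    ring

/-- The interval `[1 - 2 ^ (-j), 1 - 2 ^ (-j-1))`, for `j < n`, and `[1 - 2 ^ (-n), 1)` for
`j = n`. For `j ≤ n`, these intervals form a partition of `[0, 1)`. -/
def dyadicVine (n j : ℕ) : ℕ × ℤ := if j < n then dyadicLeft (dyadicTail j) else dyadicTail n

theorem dyadicVine_of_lt {n j : ℕ} (h : j < n) : dyadicVine n j = dyadicLeft (dyadicTail j) :=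
  if_pos h

theorem dyadicVine_self (n : ℕ) : dyadicVine n n = dyadicTail n := if_neg (lt_irrefl n)

theorem MemDyadic.of_tail_succ {x : Set.Ico (0 : ℝ) 1} {i j : ℕ} (hij : i ≤ j)
    (h : MemDyadic x (dyadicTail j)) : MemDyadic x (dyadicTail i) := by
  induction j, hij using Nat.le_induction with
  | base => exact h
  | succ j _ ih => exact ih (by rw [← dyadicRight_tail] at h; exact h.of_right)

theorem notMem_dyadicRight_of_left {x : Set.Ico (0 : ℝ) 1} {I : ℕ × ℤ}
    (h : MemDyadic x (dyadicLeft I)) : ¬ MemDyadic x (dyadicRight I) := by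
  intro h'
  have := h.unique h'
  omega

theorem notMem_tail {x : Set.Ico (0 : ℝ) 1} {i j : ℕ} (hij : j < i)
    (h : MemDyadic x (dyadicLeft (dyadicTail j))) : ¬ MemDyadic x (dyadicTail i) := fun h' =>
  notMem_dyadicRight_of_left h (by rw [dyadicRight_tail]; exact h'.of_tail_succ hij)

theorem MapsAffine.tail_of_le {g : Equiv.Perm (Set.Ico (0 : ℝ) 1)} {i j : ℕ} (hij : i ≤ j)
    (h : MapsAffine g (dyadicTail i) (dyadicTail (i + 1))) :
    MapsAffine g (dyadicTail j) (dyadicTail (j + 1)) := by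
  induction j, hij using Nat.le_induction with
  | base => exact h
  | succ j _ ih => simpa only [dyadicRight_tail] using ih.right

theorem thompsonX_tail {i : ℕ} (hi : 1 ≤ i) :
    MapsAffine thompsonX (dyadicTail i) (dyadicTail (i + 1)) :=
  MapsAffine.tail_of_le hi thompsonX_maps_right

/-- The permutation acting on `[1 - 2 ^ (-i), 1)` as a rescaled copy of `f`, and as the identity
elsewhere. -/
noncomputable def tailCopy (i : ℕ) (f : Equiv.Perm (Set.Ico (0 : ℝ) 1)) :
    Equiv.Perm (Set.Ico (0 : ℝ) 1) :=
  dyadicCopy (dyadicTail i) (dyadicTail_valid i) f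

theorem tailCopy_zero (f : Equiv.Perm (Set.Ico (0 : ℝ) 1)) : tailCopy 0 f = f :=
  dyadicCopy_zero f _

/-- Conjugation by `thompsonX` turns the copy on tail `i` into the copy on tail `i + 1`, but only
for `i ≥ 1`, since `thompsonX` is not affine on all of `[0, 1)`. Hence the cases `0` and `1` are
both assumed. -/
theorem tailCopy_mem {K : Subgroup (Equiv.Perm (Set.Ico (0 : ℝ) 1))} (hX : thompsonX ∈ K)
    {f : Equiv.Perm (Set.Ico (0 : ℝ) 1)} (h0 : f ∈ K) (h1 : tailCopy 1 f ∈ K) (i : ℕ) :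
    tailCopy i f ∈ K := by
  obtain rfl | hi := Nat.eq_zero_or_pos i
  · rwa [tailCopy_zero]
  · induction i, (hi : 1 ≤ i) using Nat.le_induction with
    | base => exact h1
    | succ i hi ih =>
      have := (thompsonX_tail hi).conj_dyadicCopy (hI := dyadicTail_valid i) (f := f)
      rw [tailCopy, ← this]
      exact K.mul_mem (K.mul_mem hX ih) (K.inv_mem hX)

theorem tailCopy_vine {i j : ℕ} (hij : j < i) (f : Equiv.Perm (Set.Ico (0 : ℝ) 1)) :
    MapsAffine (tailCopy i f) (dyadicLeft (dyadicTail j)) (dyadicLeft (dyadicTail j)) := by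
  intro x hx
  rw [tailCopy, dyadicCopy_of_notMem (notMem_tail hij hx)]

theorem MapsAffine.tailCopy {i : ℕ} {f : Equiv.Perm (Set.Ico (0 : ℝ) 1)} {I J I' J' : ℕ × ℤ}
    (h : MapsAffine f I J) (hI : DyadicValid I) (eI : dyadicSub (dyadicTail i) I = I')
    (eJ : dyadicSub (dyadicTail i) J = J') : MapsAffine (tailCopy i f) I' J' := by
  subst eI eJ
  exact h.copy hI

/-- With the next two lemmas, this describes a tree rotation: when tooth `j` of the comb has been
split in two, the copy of `thompsonX` on tail `j` spreads the halves over teeth `j` and `j + 1` and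
pushes the later teeth along by one. -/
theorem tailCopy_thompsonX_left (i : ℕ) :
    MapsAffine (tailCopy i thompsonX) (dyadicLeft (dyadicLeft (dyadicTail i)))
      (dyadicLeft (dyadicTail i)) := by
  refine thompsonX_maps_left.tailCopy (by constructor <;> norm_num) ?_ ?_ <;>
    simp only [dyadicSub, dyadicTail, dyadicLeft, Prod.mk.injEq] <;> refine ⟨trivial, ?_⟩ <;> ring

theorem tailCopy_thompsonX_mid (i : ℕ) :
    MapsAffine (tailCopy i thompsonX) (dyadicRight (dyadicLeft (dyadicTail i)))
      (dyadicLeft (dyadicTail (i + 1))) := by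
  refine thompsonX_maps_mid.tailCopy (by constructor <;> norm_num) ?_ ?_ <;>
    simp only [dyadicSub, dyadicTail, dyadicLeft, dyadicRight, Prod.mk.injEq] <;> refine ⟨trivial, ?_⟩ <;>
    ring

theorem tailCopy_thompsonX_tail {i j : ℕ} (hij : i < j) :
    MapsAffine (tailCopy i thompsonX) (dyadicTail j) (dyadicTail (j + 1)) := by
  refine MapsAffine.tail_of_le hij ?_
  refine thompsonX_maps_right.tailCopy (by constructor <;> norm_num) ?_ ?_ <;>
    simp only [dyadicSub, dyadicTail, Nat.succ_eq_add_one, Prod.mk.injEq] <;>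
    refine ⟨trivial, ?_⟩ <;> ring

/-! ### Ordered dyadic partitions and their reduction to the comb -/

/-- The standard dyadic intervals `Q 0, …, Q n` form a partition of `[0, 1)`, in this order. -/
structure IsSortedPartition (n : ℕ) (Q : ℕ → ℕ × ℤ) : Prop where
  valid : ∀ j ≤ n, DyadicValid (Q j)
  first : (Q 0).2 = 0
  step : ∀ j < n, ((Q j).2 + 1) * 2 ^ (Q (j + 1)).1 = (Q (j + 1)).2 * 2 ^ (Q j).1
  last : (Q n).2 + 1 = 2 ^ (Q n).1

theorem exists_dyadic_halves {m : ℕ} (hm : 1 ≤ m) (b : ℤ) (hb : b % 2 = 0) :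
    ∃ P, dyadicLeft P = (m, b) ∧ dyadicRight P = (m, b + 1) := by
  refine ⟨(m - 1, b / 2), ?_, ?_⟩ <;> simp only [dyadicLeft, dyadicRight, Prod.mk.injEq] <;> omega

/-- Uniqueness of lowest terms: `a / 2 ^ m` with `a` odd cannot be written with a smaller exponent.
-/
theorem eq_of_mul_two_pow_eq {a b : ℤ} {m k : ℕ} (ha : a % 2 = 1) (hk : k ≤ m)
    (h : a * 2 ^ k = b * 2 ^ m) : k = m ∧ a = b := by
  obtain ⟨d, rfl⟩ := Nat.exists_eq_add_of_le hk
  have h2 : a = b * 2 ^ d := by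
    have : (2 : ℤ) ^ k ≠ 0 := by positivity
    apply mul_right_cancel₀ this
    rw [h, pow_add]
    ring
  cases d with
  | zero => exact ⟨rfl, by simpa using h2⟩
  | succ d =>
    exfalso
    rw [pow_succ, ← mul_assoc] at h2
    omega

/-- Take an interval of greatest level. One of its endpoints has an odd numerator at that level, so
the neighbour sharing this endpoint must have the same level, and the two are the halves of one
interval. -/
theorem IsSortedPartition.exists_siblings {n : ℕ} {Q : ℕ → ℕ × ℤ}
    (h : IsSortedPartition (n + 1) Q) :
    ∃ j ≤ n, ∃ P, Q j = dyadicLeft P ∧ Q (j + 1) = dyadicRight P := by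
  obtain ⟨j, hj, hmax⟩ := Finset.exists_max_image (Finset.range (n + 2)) (fun j => (Q j).1)
    ⟨0, by simp⟩
  simp only [Finset.mem_range] at hj hmax
  have hm : 1 ≤ (Q j).1 := by
    by_contra! hm
    have h0 : (Q 0).1 = 0 := by have := hmax 0 (by omega); omega
    have h1 : (Q (0 + 1)).1 = 0 := by have := hmax 1 (by omega); simp; omega
    have h2 := h.step 0 (by omega)
    have h3 := (h.valid (0 + 1) (by omega)).2
    rw [h0, h1, h.first] at h2
    rw [h1] at h3
    omega
  rcases Int.emod_two_eq_zero_or_one (Q j).2 with hb | hb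
  · have hjn : j ≤ n := by
      by_contra! hjn
      obtain rfl : j = n + 1 := by omega
      have := h.last
      obtain ⟨k, hk⟩ := Nat.exists_eq_add_of_le hm
      rw [hk, pow_add] at this
      omega
    obtain ⟨P, hP, hP'⟩ := exists_dyadic_halves hm _ hb
    obtain ⟨e1, e2⟩ := eq_of_mul_two_pow_eq (by omega) (hmax (j + 1) (by omega))
      (h.step j (by omega))
    exact ⟨j, hjn, P, hP.symm, by rw [hP']; exact Prod.ext e1 e2.symm⟩
  · cases j with
    | zero => rw [h.first] at hb; omega
    | succ j =>
      obtain ⟨e1, e2⟩ := eq_of_mul_two_pow_eq hb (hmax j (by omega)) (h.step j (by omega)).symm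
      obtain ⟨P, hP, hP'⟩ := exists_dyadic_halves (m := (Q j).1) (by omega) (Q j).2 (by omega)
      exact ⟨j, by omega, P, hP.symm, by rw [hP']; exact Prod.ext e1.symm e2⟩

/-- Replace the entries `j` and `j + 1` of a sequence by the single entry `P`. -/
def mergeAt {α : Type*} (Q : ℕ → α) (j : ℕ) (P : α) (i : ℕ) : α :=
  if i < j then Q i else if i = j then P else Q (i + 1)

section mergeAt

variable {α : Type*} (Q : ℕ → α) {i j : ℕ} (P : α)

theorem mergeAt_lt (h : i < j) : mergeAt Q j P i = Q i := if_pos h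

theorem mergeAt_self : mergeAt Q j P j = P := by simp [mergeAt]

theorem mergeAt_gt (h : j < i) : mergeAt Q j P i = Q (i + 1) := by
  rw [mergeAt, if_neg (by omega), if_neg (by omega)]

end mergeAt

theorem DyadicValid.of_left {I : ℕ × ℤ} (h : DyadicValid (dyadicLeft I)) : DyadicValid I := by
  obtain ⟨h1, h2⟩ := h
  simp only [dyadicLeft, pow_succ] at h1 h2
  constructor <;> linarith

theorem IsSortedPartition.merge {n : ℕ} {Q : ℕ → ℕ × ℤ} (h : IsSortedPartition (n + 1) Q)
    {j : ℕ} (hj : j ≤ n) {P : ℕ × ℤ} (hl : Q j = dyadicLeft P) (hr : Q (j + 1) = dyadicRight P) :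
    IsSortedPartition n (mergeAt Q j P) where
  valid i hi := by
    obtain hij | rfl | hij := lt_trichotomy i j
    · rw [mergeAt_lt _ _ hij]; exact h.valid i (by omega)
    · rw [mergeAt_self]; exact (hl ▸ h.valid i (by omega)).of_left
    · rw [mergeAt_gt _ _ hij]; exact h.valid _ (by omega)
  first := by
    obtain rfl | hj := Nat.eq_zero_or_pos j
    · rw [mergeAt_self]
      have := h.first
      rw [hl] at this
      simp only [dyadicLeft] at this
      omega
    · rw [mergeAt_lt _ _ hj, h.first]
  step i hi := by
    obtain hij | rfl | hij := lt_trichotomy i j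
    · rw [mergeAt_lt _ _ hij]
      obtain hij' | rfl := lt_or_eq_of_le (Nat.succ_le_of_lt hij)
      · rw [mergeAt_lt _ _ hij', h.step i (by omega)]
      · have := h.step i (by omega)
        rw [mergeAt_self]
        simp only [Nat.succ_eq_add_one] at hl
        rw [hl] at this
        simp only [dyadicLeft, pow_succ] at this
        linarith
    · rw [mergeAt_self, mergeAt_gt _ _ (Nat.lt_succ_self _)]
      have := h.step (i + 1) (by omega)
      rw [hr] at this
      simp only [dyadicRight, pow_succ] at this
      linarith
    · rw [mergeAt_gt _ _ hij, mergeAt_gt _ _ (by omega)]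
      exact h.step (i + 1) (by omega)
  last := by
    obtain rfl | hj := eq_or_lt_of_le hj
    · rw [mergeAt_self]
      have := h.last
      rw [hr] at this
      simp only [dyadicRight, pow_succ] at this
      linarith
    · rw [mergeAt_gt _ _ hj]
      exact h.last

/-- Induction on the number of intervals: merge two siblings, move the coarser partition to the
comb, and split again. If the merged interval became the last tail, the result is already a comb;
otherwise one rotation repairs it. -/
theorem exists_mapsAffine_vine {K : Subgroup (Equiv.Perm (Set.Ico (0 : ℝ) 1))}
    (hX : thompsonX ∈ K) (hX' : tailCopy 1 thompsonX ∈ K) {n : ℕ} {Q : ℕ → ℕ × ℤ}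
    (hQ : IsSortedPartition n Q) : ∃ h ∈ K, ∀ j ≤ n, MapsAffine h (Q j) (dyadicVine n j) := by
  induction n generalizing Q with
  | zero =>
    refine ⟨1, K.one_mem, fun j hj => ?_⟩
    obtain rfl : j = 0 := by omega
    have e : Q 0 = dyadicVine 0 0 := by
      have h1 := hQ.last
      rw [hQ.first, zero_add] at h1
      refine Prod.ext ?_ hQ.first
      by_contra hne
      obtain ⟨k, hk⟩ := Nat.exists_eq_succ_of_ne_zero (n := (Q 0).1) hne
      rw [hk, pow_succ] at h1
      omega
    rw [e]
    exact .one _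
  | succ n ih =>
    obtain ⟨j, hj, P, hl, hr⟩ := hQ.exists_siblings
    obtain ⟨h, hK, hh⟩ := ih (hQ.merge hj hl hr)
    have hP := hh j hj
    rw [mergeAt_self] at hP
    have hlt : ∀ i < j, MapsAffine h (Q i) (dyadicLeft (dyadicTail i)) := by
      intro i hi
      have := hh i (by omega)
      rwa [mergeAt_lt _ _ hi, dyadicVine_of_lt (by omega)] at this
    obtain rfl | hjn := eq_or_lt_of_le hj
    · rw [dyadicVine_self] at hP
      refine ⟨h, hK, fun i hi => ?_⟩
      obtain hij | rfl | hij := lt_trichotomy i j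
      · rw [dyadicVine_of_lt (by omega)]
        exact hlt i hij
      · rw [hl, dyadicVine_of_lt (by omega)]
        exact hP.left
      · obtain rfl : i = j + 1 := by omega
        rw [hr, dyadicVine_self, ← dyadicRight_tail]
        exact hP.right
    · rw [dyadicVine_of_lt hjn] at hP
      -- Tooth `j` is now split into its halves; the rotation based at tail `j` straightens the comb
      -- and leaves the earlier teeth fixed.
      refine ⟨tailCopy j thompsonX * h, K.mul_mem (tailCopy_mem hX hX hX' j) hK, fun i hi => ?_⟩
      obtain hij | rfl | hij := lt_trichotomy i j
      · rw [dyadicVine_of_lt (by omega)]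
        exact (tailCopy_vine hij _).mul (hlt i hij)
      · rw [hl, dyadicVine_of_lt (by omega)]
        exact (tailCopy_thompsonX_left i).mul hP.left
      · obtain rfl | hij := eq_or_lt_of_le (Nat.succ_le_of_lt hij)
        · simp only [Nat.succ_eq_add_one]
          rw [hr, dyadicVine_of_lt (by omega)]
          exact (tailCopy_thompsonX_mid j).mul hP.right
        · obtain ⟨i, rfl⟩ : ∃ i', i = i' + 1 := ⟨i - 1, by omega⟩
          have := hh i (by omega)
          rw [mergeAt_gt _ _ (by omega)] at this
          refine MapsAffine.mul ?_ this
          obtain hin | rfl := lt_or_eq_of_le (show i ≤ n by omega)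
          · rw [dyadicVine_of_lt hin, dyadicVine_of_lt (by omega)]
            exact (tailCopy_thompsonX_tail (by omega)).left
          · rw [dyadicVine_self, dyadicVine_self]
            exact tailCopy_thompsonX_tail (by omega)

theorem isSortedPartition_uniform (L : ℕ) :
    IsSortedPartition (2 ^ L - 1) fun j => (L, (j : ℤ)) where
  valid j hj := by
    have : 0 < 2 ^ L := by positivity
    refine ⟨by simp, ?_⟩
    simp only
    have : j < 2 ^ L := by omega
    exact_mod_cast this
  first := rfl
  step j _ := by push_cast; ring
  last := by
    have : 0 < 2 ^ L := by positivity
    simp only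
    have : 2 ^ L - 1 + 1 = 2 ^ L := by omega
    exact_mod_cast this

theorem exists_memDyadic_uniform (x : Set.Ico (0 : ℝ) 1) (L : ℕ) :
    ∃ j ≤ 2 ^ L - 1, MemDyadic x (L, ((j : ℕ) : ℤ)) := by
  obtain ⟨a, ha⟩ := exists_memDyadic x L
  obtain ⟨h0, h1⟩ := ha.valid
  simp only at h0 h1
  lift a to ℕ using h0
  exact ⟨a, by have : a < 2 ^ L := by exact_mod_cast h1
               omega, ha⟩

/-! ### Increasing elements of `V` are generated by two elements -/

section StrictMono

variable {g : Equiv.Perm (Set.Ico (0 : ℝ) 1)} {I J : ℕ × ℤ}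

/-- The left endpoint of `I` goes to the left endpoint of `J`, and `g` preserves order, so the
points to the left of `I` are exactly those sent to the left of `J`. -/
theorem MapsAffine.lt_iff (h : MapsAffine g I J) (hI : DyadicValid I) (hg : StrictMono g)
    (x : Set.Ico (0 : ℝ) 1) : (2 : ℝ) ^ J.1 * (g x : ℝ) < J.2 ↔ (2 : ℝ) ^ I.1 * (x : ℝ) < I.2 := by
  have hc := h.apply_coord hI ⟨0, by simp⟩
  have h1 := two_pow_mul_dyadicCoord I hI ⟨0, by simp⟩
  have h2 := two_pow_mul_dyadicCoord J (h.valid hI) ⟨0, by simp⟩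
  rw [← hc] at h2
  set c := (dyadicCoord I hI ⟨0, by simp⟩).1
  simp only [add_zero] at h1 h2
  rw [← h1, ← h2, mul_lt_mul_iff_right₀ (by positivity), mul_lt_mul_iff_right₀ (by positivity),
    Subtype.coe_lt_coe, Subtype.coe_lt_coe, hg.lt_iff_lt]

theorem MapsAffine.le_iff (h : MapsAffine g I J) (hI : DyadicValid I) (hg : StrictMono g)
    (x : Set.Ico (0 : ℝ) 1) :
    (J.2 : ℝ) + 1 ≤ 2 ^ J.1 * (g x : ℝ) ↔ (I.2 : ℝ) + 1 ≤ 2 ^ I.1 * (x : ℝ) := by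
  have h1 := h.lt_iff hI hg x
  have h2 := h.mem_iff hI (x := x)
  simp only [MemDyadic] at h2
  constructor
  · intro hx
    by_contra! hc
    have := h1.not.1 (by linarith)
    linarith [(h2.2 ⟨by linarith, hc⟩).2]
  · intro hx
    by_contra! hc
    have := h1.not.2 (by linarith)
    linarith [(h2.1 ⟨by linarith, hc⟩).2]

theorem StrictMono.isSortedPartition (hg : StrictMono g) {L : ℕ} {Q : ℕ → ℕ × ℤ}
    (hQ : ∀ j : ℕ, j ≤ 2 ^ L - 1 → MapsAffine g (L, (j : ℤ)) (Q j)) :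
    IsSortedPartition (2 ^ L - 1) Q := by
  have hU := isSortedPartition_uniform L
  have hv : ∀ j : ℕ, j ≤ 2 ^ L - 1 → DyadicValid (Q j) := fun j hj => (hQ j hj).valid (hU.valid j hj)
  refine ⟨hv, ?_, ?_, ?_⟩
  · by_contra hne
    have h1 : (0 : ℝ) < (Q 0).2 := by
      exact_mod_cast lt_of_le_of_ne (hv 0 (by omega)).1 (Ne.symm hne)
    obtain ⟨x, hx⟩ := g.surjective ⟨0, by simp⟩
    have := ((hQ 0 (by omega)).lt_iff (hU.valid 0 (by omega)) hg x).1 (by rw [hx]; simpa using h1)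
    simp only [Nat.cast_zero, Int.cast_zero] at this
    have hx0 := x.2.1
    have : 0 ≤ (2 : ℝ) ^ L * x := by positivity
    linarith
  · intro j hj
    have hI := hU.valid (j + 1) (by omega)
    set c := (dyadicCoord _ hI ⟨0, by simp⟩).1 with hc
    have hc1 := two_pow_mul_dyadicCoord _ hI ⟨0, by simp⟩
    have hc2 := two_pow_mul_dyadicCoord _ (hv (j + 1) (by omega)) ⟨0, by simp⟩
    have hgc := (hQ (j + 1) (by omega)).apply_coord hI ⟨0, by simp⟩
    rw [← hgc] at hc2
    simp only [← hc, add_zero] at hc1 hc2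
    push_cast at hc1
    have hle := (hQ j (by omega)).le_iff (hU.valid j (by omega)) hg
    have h1 := (hle c).2 (by rw [hc1]; simp)
    have hp : (0 : ℝ) < 2 ^ (Q j).1 := by positivity
    have hp' : (0 : ℝ) < 2 ^ (Q (j + 1)).1 := by positivity
    have h0 : (0 : ℝ) ≤ (Q j).2 := by exact_mod_cast (hv j (by omega)).1
    -- The right endpoint of `Q j` is the value of `g` at some `x`. This `x` lies to the right of
    -- cell `j`, so `c ≤ x` and `g c` is at most that endpoint; `h1` is the reverse inequality. Thus
    -- there is no gap before `Q (j + 1)`, whose left endpoint is `g c`.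
    obtain ⟨x, hx⟩ := g.surjective ⟨((Q j).2 + 1) / 2 ^ (Q j).1, by positivity, by
      rw [div_lt_one hp]
      nlinarith [(g c).2.2]⟩
    have hx' : (2 : ℝ) ^ (Q j).1 * (g x : ℝ) = (Q j).2 + 1 := by
      rw [hx, mul_div_cancel₀ _ hp.ne']
    have h2 := (hle x).1 hx'.ge
    have h3 : c ≤ x := by
      rw [← Subtype.coe_le_coe]
      refine le_of_mul_le_mul_left ?_ (show (0 : ℝ) < 2 ^ L by positivity)
      rw [hc1]
      simpa using h2
    have h4 : (g c : ℝ) ≤ g x := hg.monotone h3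
    have h5 : (2 : ℝ) ^ (Q j).1 * (g c : ℝ) = (Q j).2 + 1 := le_antisymm (by nlinarith) h1
    have h6 : (((Q j).2 : ℝ) + 1) * 2 ^ (Q (j + 1)).1 = (Q (j + 1)).2 * 2 ^ (Q j).1 := by
      rw [← h5, ← hc2]
      ring
    exact_mod_cast h6
  · by_contra hne
    set n := 2 ^ L - 1 with hn
    obtain ⟨h0, h1⟩ := hv n le_rfl
    have h2 : ((Q n).2 : ℝ) + 1 < 2 ^ (Q n).1 := by
      exact_mod_cast lt_of_le_of_ne (Int.add_one_le_iff.2 h1) hne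
    have h0 : (0 : ℝ) ≤ (Q n).2 := by exact_mod_cast h0
    have hp : (0 : ℝ) < 2 ^ (Q n).1 := by positivity
    obtain ⟨x, hx⟩ := g.surjective ⟨((Q n).2 + 1) / 2 ^ (Q n).1, by positivity, by
      rwa [div_lt_one hp]⟩
    have := ((hQ n le_rfl).le_iff (hU.valid n le_rfl) hg x).1
      (by rw [hx, mul_div_cancel₀ _ hp.ne'])
    have hL : (((n : ℕ) : ℤ) : ℝ) + 1 = 2 ^ L := by
      have e := congrArg (Int.cast : ℤ → ℝ) hU.last
      simp only at e
      push_cast at e ⊢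
      exact e
    simp only [hL] at this
    have hL0 : (0 : ℝ) < 2 ^ L := by positivity
    nlinarith [x.2.2]

/-- The source partition and its image are ordered and equally numerous, so both reduce to the same
comb; comparing the two reductions expresses `g` through elements of `K`. -/
theorem mem_of_strictMono_of_mem_thompsonV {K : Subgroup (Equiv.Perm (Set.Ico (0 : ℝ) 1))}
    (hX : thompsonX ∈ K) (hX' : tailCopy 1 thompsonX ∈ K) (hg : StrictMono g)
    (hV : g ∈ thompsonV) : g ∈ K := by
  obtain ⟨L, hL⟩ := mem_thompsonV_iff.1 hV
  choose Q hQ using fun j : ℕ => hL ((j : ℕ) : ℤ)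
  obtain ⟨h, hh, hh'⟩ := exists_mapsAffine_vine hX hX' (isSortedPartition_uniform L)
  obtain ⟨k, hk, hk'⟩ := exists_mapsAffine_vine hX hX'
    (hg.isSortedPartition (L := L) fun j _ => hQ j)
  have e : k * g = h := by
    ext1 x
    obtain ⟨j, hj, hx⟩ := exists_memDyadic_uniform x L
    exact ((hk' j hj).mul (hQ j)).eq_of_mem (hh' j hj) hx
  rw [← inv_mul_eq_iff_eq_mul.2 e.symm]
  exact K.mul_mem (K.inv_mem hk) hh

end StrictMono

/-! ## Finite generation of `V` -/

/-- The involution exchanging `[0, 1/2)` and `[1/2, 3/4)`. -/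
noncomputable def thompsonSwap : Equiv.Perm (Set.Ico (0 : ℝ) 1) :=
  Function.Involutive.toPerm (fun x => ⟨if (x : ℝ) < 1 / 2 then x / 2 + 1 / 2 else
      if (x : ℝ) < 3 / 4 then 2 * x - 1 else x,
    by have := x.2.1; have := x.2.2; constructor <;> split_ifs <;> linarith⟩) (by
    intro x
    apply Subtype.ext
    have := x.2.1
    simp only
    split_ifs <;> linarith)

theorem thompsonSwap_apply (x : Set.Ico (0 : ℝ) 1) : (thompsonSwap x : ℝ) =
    if (x : ℝ) < 1 / 2 then (x : ℝ) / 2 + 1 / 2 else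
      if (x : ℝ) < 3 / 4 then 2 * (x : ℝ) - 1 else (x : ℝ) := rfl

theorem thompsonSwap_maps_left : MapsAffine thompsonSwap (1, 0) (2, 2) := by
  rintro x ⟨h1, h2⟩
  norm_num at h1 h2 ⊢
  rw [thompsonSwap_apply]
  split_ifs <;> linarith

theorem thompsonSwap_maps_mid : MapsAffine thompsonSwap (2, 2) (1, 0) := by
  rintro x ⟨h1, h2⟩
  norm_num at h1 h2 ⊢
  rw [thompsonSwap_apply]
  split_ifs <;> linarith

theorem thompsonSwap_maps_right : MapsAffine thompsonSwap (2, 3) (2, 3) := by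
  rintro x ⟨h1, h2⟩
  norm_num at h1 h2 ⊢
  rw [thompsonSwap_apply]
  split_ifs <;> linarith

theorem thompsonSwap_mem_thompsonV : thompsonSwap ∈ thompsonV := by
  rw [mem_thompsonV_iff]
  refine ⟨2, fun j => ?_⟩
  by_cases hj : DyadicValid (2, j)
  · obtain ⟨h0, h1⟩ := hj
    simp only at h0 h1
    norm_num at h1
    interval_cases j
    · exact ⟨_, thompsonSwap_maps_left.left⟩
    · exact ⟨_, thompsonSwap_maps_left.right⟩
    · exact ⟨_, thompsonSwap_maps_mid⟩
    · exact ⟨_, thompsonSwap_maps_right⟩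
  · exact ⟨(0, 0), .of_not_valid hj _⟩

/-- The involution exchanging `[0, 1/2)` and `[1/2, 1)`. -/
noncomputable def halfTurn : Equiv.Perm (Set.Ico (0 : ℝ) 1) :=
  Function.Involutive.toPerm (fun x => ⟨if (x : ℝ) < 1 / 2 then x + 1 / 2 else x - 1 / 2,
    by have := x.2.1; have := x.2.2; constructor <;> split_ifs <;> linarith⟩) (by
    intro x
    apply Subtype.ext
    have := x.2.1
    have := x.2.2
    simp only
    split_ifs <;> linarith)

theorem halfTurn_apply (x : Set.Ico (0 : ℝ) 1) : (halfTurn x : ℝ) =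
    if (x : ℝ) < 1 / 2 then (x : ℝ) + 1 / 2 else (x : ℝ) - 1 / 2 := rfl

theorem halfTurn_maps_left : MapsAffine halfTurn (1, 0) (1, 1) := by
  rintro x ⟨h1, h2⟩
  norm_num at h1 h2 ⊢
  rw [halfTurn_apply]
  split_ifs <;> linarith

theorem halfTurn_maps_right : MapsAffine halfTurn (1, 1) (1, 0) := by
  rintro x ⟨h1, h2⟩
  norm_num at h1 h2 ⊢
  rw [halfTurn_apply]
  split_ifs <;> linarith

theorem halfTurn_mem_thompsonV : halfTurn ∈ thompsonV := by
  rw [mem_thompsonV_iff]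
  refine ⟨1, fun j => ?_⟩
  by_cases hj : DyadicValid (1, j)
  · obtain ⟨h0, h1⟩ := hj
    simp only at h0 h1
    norm_num at h1
    interval_cases j
    · exact ⟨_, halfTurn_maps_left⟩
    · exact ⟨_, halfTurn_maps_right⟩
  · exact ⟨(0, 0), .of_not_valid hj _⟩

/-! ### Permuting the intervals of the comb -/

theorem tailCopy_thompsonSwap_left (i : ℕ) :
    MapsAffine (tailCopy i thompsonSwap) (dyadicLeft (dyadicTail i))
      (dyadicLeft (dyadicTail (i + 1))) := by
  refine thompsonSwap_maps_left.tailCopy (by constructor <;> norm_num) ?_ ?_ <;>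
    simp only [dyadicSub, dyadicTail, dyadicLeft, Prod.mk.injEq] <;> refine ⟨trivial, ?_⟩ <;> ring

theorem tailCopy_thompsonSwap_mid (i : ℕ) :
    MapsAffine (tailCopy i thompsonSwap) (dyadicLeft (dyadicTail (i + 1)))
      (dyadicLeft (dyadicTail i)) := by
  refine thompsonSwap_maps_mid.tailCopy (by constructor <;> norm_num) ?_ ?_ <;>
    simp only [dyadicSub, dyadicTail, dyadicLeft, Prod.mk.injEq] <;> refine ⟨trivial, ?_⟩ <;> ring

theorem tailCopy_thompsonSwap_tail (i : ℕ) :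
    MapsAffine (tailCopy i thompsonSwap) (dyadicTail (i + 2)) (dyadicTail (i + 2)) := by
  refine thompsonSwap_maps_right.tailCopy (by constructor <;> norm_num) ?_ ?_ <;>
    simp only [dyadicSub, dyadicTail, Prod.mk.injEq] <;> refine ⟨trivial, ?_⟩ <;> ring

theorem tailCopy_halfTurn_left (i : ℕ) :
    MapsAffine (tailCopy i halfTurn) (dyadicLeft (dyadicTail i)) (dyadicTail (i + 1)) := by
  refine halfTurn_maps_left.tailCopy (by constructor <;> norm_num) ?_ ?_ <;>
    simp only [dyadicSub, dyadicTail, dyadicLeft, Prod.mk.injEq] <;> refine ⟨trivial, ?_⟩ <;> ring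

theorem tailCopy_halfTurn_right (i : ℕ) :
    MapsAffine (tailCopy i halfTurn) (dyadicTail (i + 1)) (dyadicLeft (dyadicTail i)) := by
  refine halfTurn_maps_right.tailCopy (by constructor <;> norm_num) ?_ ?_ <;>
    simp only [dyadicSub, dyadicTail, dyadicLeft, Prod.mk.injEq] <;> refine ⟨trivial, ?_⟩ <;> ring

theorem MapsAffine.vine_self {g : Equiv.Perm (Set.Ico (0 : ℝ) 1)} {k n j : ℕ}
    (h : MapsAffine g (dyadicTail k) (dyadicTail k)) (hkj : k ≤ j) (hjn : j ≤ n) :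
    MapsAffine g (dyadicVine n j) (dyadicVine n j) := by
  have key : MapsAffine g (dyadicTail j) (dyadicTail j) := by
    induction j, hkj using Nat.le_induction with
    | base => exact h
    | succ j _ ih => simpa only [dyadicRight_tail] using (ih (by omega)).right
  obtain hjn | rfl := lt_or_eq_of_le hjn
  · rw [dyadicVine_of_lt hjn]
    exact key.left
  · rwa [dyadicVine_self]

section Generation

variable {K : Subgroup (Equiv.Perm (Set.Ico (0 : ℝ) 1))} (hX : thompsonX ∈ K)
  (hS : thompsonSwap ∈ K) (hS' : tailCopy 1 thompsonSwap ∈ K)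
  (hR : halfTurn ∈ K) (hR' : tailCopy 1 halfTurn ∈ K)

include hX hS hS' hR hR'

/-- Teeth `i` and `i + 1` have lengths in ratio two to one and are exchanged by `thompsonSwap` on
tail `i`. The last two intervals have equal length, so there `halfTurn` is needed instead. -/
theorem exists_swap_vine (n : ℕ) (i : Fin n) :
    ∃ v ∈ K, ∀ j : Fin (n + 1), MapsAffine v (dyadicVine n j)
      (dyadicVine n (Equiv.swap i.castSucc i.succ j : Fin (n + 1))) := by
  obtain ⟨i, hi⟩ := i
  have hfix : ∀ f : Equiv.Perm (Set.Ico (0 : ℝ) 1), ∀ j < i,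
      MapsAffine (tailCopy i f) (dyadicVine n j) (dyadicVine n j) := by
    intro f j hj
    rw [dyadicVine_of_lt (by omega)]
    exact tailCopy_vine hj f
  obtain hin | hin := lt_or_eq_of_le (Nat.succ_le_of_lt hi)
  · refine ⟨tailCopy i thompsonSwap, tailCopy_mem hX hS hS' i, ?_⟩
    rintro ⟨j, hj⟩
    obtain hij | rfl | hij := lt_trichotomy j i
    · rw [Equiv.swap_apply_of_ne_of_ne (by simp [Fin.ext_iff]; omega)
        (by simp [Fin.ext_iff]; omega)]
      exact hfix _ j hij
    · have : (⟨j, hj⟩ : Fin (n + 1)) = Fin.castSucc ⟨j, hi⟩ := rfl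
      rw [this, Equiv.swap_apply_left]
      simp only [Fin.val_castSucc, Fin.val_succ]
      rw [dyadicVine_of_lt hi, dyadicVine_of_lt hin]
      exact tailCopy_thompsonSwap_left j
    · obtain rfl | hij := eq_or_lt_of_le (Nat.succ_le_of_lt hij)
      · have : (⟨i.succ, hj⟩ : Fin (n + 1)) = Fin.succ ⟨i, hi⟩ := rfl
        rw [this, Equiv.swap_apply_right]
        simp only [Fin.val_castSucc, Fin.val_succ]
        rw [dyadicVine_of_lt hi, dyadicVine_of_lt hin]
        exact tailCopy_thompsonSwap_mid i
      · rw [Equiv.swap_apply_of_ne_of_ne (by simp [Fin.ext_iff]; omega)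
          (by simp [Fin.ext_iff]; omega)]
        exact (tailCopy_thompsonSwap_tail i).vine_self hij (by simp only; omega)
  · refine ⟨tailCopy i halfTurn, tailCopy_mem hX hR hR' i, ?_⟩
    subst hin
    rintro ⟨j, hj⟩
    obtain hij | rfl | hij := lt_trichotomy j i
    · rw [Equiv.swap_apply_of_ne_of_ne (by simp [Fin.ext_iff]; omega)
        (by simp [Fin.ext_iff]; omega)]
      exact hfix _ j hij
    · have : (⟨j, hj⟩ : Fin (j + 1 + 1)) = Fin.castSucc ⟨j, hi⟩ := rfl
      rw [this, Equiv.swap_apply_left]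
      simp only [Fin.val_castSucc, Fin.val_succ]
      rw [dyadicVine_of_lt hi, dyadicVine_self]
      exact tailCopy_halfTurn_left j
    · obtain rfl : j = i + 1 := by omega
      have : (⟨i + 1, hj⟩ : Fin (i + 1 + 1)) = Fin.succ ⟨i, hi⟩ := rfl
      rw [this, Equiv.swap_apply_right]
      simp only [Fin.val_castSucc, Fin.val_succ]
      rw [dyadicVine_of_lt hi, dyadicVine_self]
      exact tailCopy_halfTurn_right i

theorem exists_perm_vine (n : ℕ) (σ : Equiv.Perm (Fin (n + 1))) :
    ∃ v ∈ K, ∀ j : Fin (n + 1), MapsAffine v (dyadicVine n j) (dyadicVine n (σ j : Fin (n + 1))) := by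
  have hσ : σ ∈ Submonoid.closure
      (Set.range fun i : Fin n => Equiv.swap i.castSucc i.succ) := by
    rw [Equiv.Perm.mclosure_swap_castSucc_succ]
    trivial
  induction hσ using Submonoid.closure_induction with
  | mem _ h =>
    obtain ⟨i, rfl⟩ := h
    exact exists_swap_vine hX hS hS' hR hR' n i
  | one => exact ⟨1, K.one_mem, fun j => .one _⟩
  | mul σ τ _ _ ih ih' =>
    obtain ⟨v, hv, h⟩ := ih
    obtain ⟨w, hw, h'⟩ := ih'
    exact ⟨v * w, K.mul_mem hv hw, fun j => (h (τ j)).mul (h' j)⟩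

end Generation

/-! ### Unordered dyadic partitions and generation of `V` -/

/-- The standard dyadic intervals `Q j` form a partition of `[0, 1)`. -/
structure IsDyadicPartition {ι : Type*} (Q : ι → ℕ × ℤ) : Prop where
  valid : ∀ j, DyadicValid (Q j)
  cover : ∀ x, ∃ j, MemDyadic x (Q j)
  disjoint : ∀ x j k, MemDyadic x (Q j) → MemDyadic x (Q k) → j = k

theorem DyadicValid.exists_mem {I : ℕ × ℤ} (h : DyadicValid I) : ∃ x, MemDyadic x I :=
  ⟨_, (dyadicCoord I h ⟨0, by simp⟩).2⟩

theorem DyadicValid.left {I : ℕ × ℤ} (h : DyadicValid I) : DyadicValid (dyadicLeft I) := by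
  obtain ⟨h1, h2⟩ := h
  constructor <;> simp only [dyadicLeft, pow_succ] <;> linarith

theorem DyadicValid.right {I : ℕ × ℤ} (h : DyadicValid I) : DyadicValid (dyadicRight I) := by
  obtain ⟨h1, h2⟩ := h
  constructor <;> simp only [dyadicRight, pow_succ] <;> linarith

/-- Again an interval of greatest level is used. A member of the partition meeting the other half of
its parent cannot be larger than that half, for it would then contain the whole parent and overlap
the chosen interval. -/
theorem IsDyadicPartition.exists_siblings {n : ℕ} {Q : Fin (n + 2) → ℕ × ℤ}
    (h : IsDyadicPartition Q) : ∃ j k P, Q j = dyadicLeft P ∧ Q k = dyadicRight P := by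
  obtain ⟨j, -, hmax⟩ := Finset.exists_max_image Finset.univ (fun j => (Q j).1) ⟨0, by simp⟩
  have hm : 1 ≤ (Q j).1 := by
    by_contra! hm
    have hm : (Q j).1 = 0 := by omega
    obtain ⟨k, hk⟩ := exists_ne j
    obtain ⟨x, hx⟩ := (h.valid k).exists_mem
    refine hk (h.disjoint x k j hx ?_)
    have := (h.valid j)
    obtain ⟨h1, h2⟩ := this
    rw [hm] at h2
    have h3 : (Q j).2 = 0 := by omega
    constructor <;> rw [hm, h3] <;> have := x.2.1 <;> have := x.2.2 <;> norm_num <;> assumption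
  -- `P` is the parent of `Q j` and `S` its other half; stated once to treat `Q j` as a left or as a
  -- right half.
  have key : ∀ P S : ℕ × ℤ, P.1 + 1 = (Q j).1 → S.1 = (Q j).1 → DyadicValid S →
      (∀ x, MemDyadic x S → MemDyadic x P) → (∀ x, MemDyadic x (Q j) → MemDyadic x P) →
      ∃ k, Q k = S := by
    intro P S hP hS hSv hSP hQP
    obtain ⟨x, hx⟩ := hSv.exists_mem
    obtain ⟨k, hk⟩ := h.cover x
    refine ⟨k, ?_⟩
    obtain hlt | heq := lt_or_eq_of_le (hmax k (Finset.mem_univ k))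
    · exfalso
      obtain ⟨d, hd⟩ := Nat.exists_eq_add_of_le (show (Q k).1 ≤ P.1 by omega)
      obtain ⟨y, hy⟩ := (h.valid j).exists_mem
      have hxP : MemDyadic x ((Q k).1 + d, P.2) := hd ▸ hSP x hx
      have hyP : MemDyadic y ((Q k).1 + d, P.2) := hd ▸ hQP y hy
      have e : (Q k).2 = P.2 / 2 ^ d := MemDyadic.unique (n := (Q k).1) hk hxP.ancestor
      have hyk : MemDyadic y (Q k) := by
        have := hyP.ancestor
        rwa [← e] at this
      have := h.disjoint y k j hyk hy
      rw [this] at hlt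
      exact lt_irrefl _ hlt
    · have e : (Q k).1 = S.1 := heq.trans hS.symm
      refine Prod.ext e (MemDyadic.unique (n := S.1) ?_ hx)
      rw [← e]
      exact hk
  rcases Int.emod_two_eq_zero_or_one (Q j).2 with hb | hb
  · obtain ⟨P, hP, hP'⟩ := exists_dyadic_halves hm _ hb
    have hjP : Q j = dyadicLeft P := hP.symm
    obtain ⟨k, hk⟩ := key P (dyadicRight P) (by rw [hjP]; rfl) (by rw [hjP]; rfl)
      (hjP ▸ h.valid j).of_left.right (fun _ => MemDyadic.of_right)
      (by rw [hjP]; exact fun _ => MemDyadic.of_left)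
    exact ⟨j, k, P, hjP, hk⟩
  · obtain ⟨P, hP, hP'⟩ := exists_dyadic_halves hm ((Q j).2 - 1) (by omega)
    have hjP : Q j = dyadicRight P := by rw [hP', sub_add_cancel]
    have hPv : DyadicValid P := by
      obtain ⟨x, hx⟩ := (h.valid j).exists_mem
      rw [hjP] at hx
      exact hx.of_right.valid
    obtain ⟨k, hk⟩ := key P (dyadicLeft P) (by rw [hjP]; rfl) (by rw [hjP]; rfl)
      hPv.left (fun _ => MemDyadic.of_left) (by rw [hjP]; exact fun _ => MemDyadic.of_right)
    exact ⟨k, j, P, hk, hjP⟩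

theorem IsDyadicPartition.comp_equiv {ι κ : Type*} {Q : ι → ℕ × ℤ} (h : IsDyadicPartition Q)
    (e : κ ≃ ι) : IsDyadicPartition (Q ∘ e) where
  valid j := h.valid _
  cover x := by
    obtain ⟨j, hj⟩ := h.cover x
    exact ⟨e.symm j, by simpa using hj⟩
  disjoint x j k hj hk := e.injective (h.disjoint x _ _ hj hk)

theorem IsDyadicPartition.merge_last {n : ℕ} {Q : Fin (n + 2) → ℕ × ℤ} (h : IsDyadicPartition Q)
    {P : ℕ × ℤ} (hl : Q (Fin.last n).castSucc = dyadicLeft P)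
    (hr : Q (Fin.last (n + 1)) = dyadicRight P) :
    IsDyadicPartition (Fin.lastCases (motive := fun _ => ℕ × ℤ) P
      fun i : Fin n => Q i.castSucc.castSucc) where
  valid j := by
    cases j using Fin.lastCases with
    | last =>
      rw [Fin.lastCases_last]
      exact (hl ▸ h.valid _).of_left
    | cast j =>
      rw [Fin.lastCases_castSucc]
      exact h.valid _
  cover x := by
    obtain ⟨j, hj⟩ := h.cover x
    cases j using Fin.lastCases with
    | last => exact ⟨Fin.last n, by rw [Fin.lastCases_last]; exact (hr ▸ hj).of_right⟩
    | cast j =>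
      cases j using Fin.lastCases with
      | last => exact ⟨Fin.last n, by rw [Fin.lastCases_last]; exact (hl ▸ hj).of_left⟩
      | cast j => exact ⟨j.castSucc, by rwa [Fin.lastCases_castSucc]⟩
  disjoint x j k hj hk := by
    have key : ∀ i : Fin n, MemDyadic x (Q i.castSucc.castSucc) → ¬ MemDyadic x P := by
      intro i hi hP
      obtain hP | hP := memDyadic_left_or_right hP
      · have := h.disjoint x _ _ hi (hl ▸ hP)
        simp [Fin.ext_iff] at this
        omega
      · have := h.disjoint x _ _ hi (hr ▸ hP)
        simp [Fin.ext_iff] at this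
        omega
    cases j using Fin.lastCases with
    | last =>
      cases k using Fin.lastCases with
      | last => rfl
      | cast k =>
        rw [Fin.lastCases_last] at hj
        rw [Fin.lastCases_castSucc] at hk
        exact (key k hk hj).elim
    | cast j =>
      cases k using Fin.lastCases with
      | last =>
        rw [Fin.lastCases_castSucc] at hj
        rw [Fin.lastCases_last] at hk
        exact (key j hj hk).elim
      | cast k =>
        rw [Fin.lastCases_castSucc] at hj hk
        exact congrArg Fin.castSucc
          (Fin.castSucc_injective _ (Fin.castSucc_injective _ (h.disjoint x _ _ hj hk)))

theorem exists_perm_apply_two {α : Type*} [DecidableEq α] {a b c d : α} (hab : a ≠ b)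
    (hcd : c ≠ d) : ∃ σ : Equiv.Perm α, σ a = c ∧ σ b = d := by
  refine ⟨Equiv.swap b d * Equiv.swap a (Equiv.swap b d c), ?_, ?_⟩
  · simp
  · have : b ≠ Equiv.swap b d c := by
      intro h
      apply hcd
      have := congrArg (Equiv.swap b d) h
      simpa using this.symm
    rw [Equiv.Perm.mul_apply, Equiv.swap_apply_of_ne_of_ne hab.symm this, Equiv.swap_apply_left]

section Generation

variable {K : Subgroup (Equiv.Perm (Set.Ico (0 : ℝ) 1))} (hX : thompsonX ∈ K)
  (hS : thompsonSwap ∈ K) (hS' : tailCopy 1 thompsonSwap ∈ K)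
  (hR : halfTurn ∈ K) (hR' : tailCopy 1 halfTurn ∈ K)

include hX hS hS' hR hR'

/-- Relabel so that two siblings come last. The merged interval is then carried to the last tail,
whose halves end the next comb, so no rotation is needed; the relabelling is undone by a permutation
of the comb. -/
theorem IsDyadicPartition.exists_mapsAffine_vine {n : ℕ} {Q : Fin (n + 1) → ℕ × ℤ}
    (hQ : IsDyadicPartition Q) : ∃ h ∈ K, ∀ j, MapsAffine h (Q j) (dyadicVine n j) := by
  induction n with
  | zero =>
    refine ⟨1, K.one_mem, fun j => ?_⟩
    obtain rfl : j = 0 := Fin.ext (by omega)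
    have hall : ∀ x, MemDyadic x (Q 0) := by
      intro x
      obtain ⟨k, hk⟩ := hQ.cover x
      rwa [show k = 0 from Fin.ext (by omega)] at hk
    have e : Q 0 = (0, 0) := by
      obtain ⟨h0, h1⟩ := hQ.valid 0
      have h2 := (hall ⟨0, by simp⟩).1
      simp only [mul_zero] at h2
      have h2 : (Q 0).2 = 0 := le_antisymm (by exact_mod_cast h2) h0
      have h3 := (hall ⟨1 / 2, by norm_num⟩).2
      rw [h2] at h3
      refine Prod.ext ?_ h2
      by_contra hne
      obtain ⟨k, hk⟩ := Nat.exists_eq_succ_of_ne_zero (n := (Q 0).1) hne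
      rw [hk, pow_succ] at h3
      have : (1 : ℝ) ≤ 2 ^ k := one_le_pow₀ (by norm_num)
      norm_num at h3
      linarith
    rw [e]
    exact .one _
  | succ n ih =>
    obtain ⟨j, k, P, hj, hk⟩ := hQ.exists_siblings
    have hjk : j ≠ k := by
      rintro rfl
      have := hj.symm.trans hk
      simp only [dyadicLeft, dyadicRight, Prod.mk.injEq] at this
      omega
    obtain ⟨σ, hσ, hσ'⟩ := exists_perm_apply_two
      (show (Fin.last n).castSucc ≠ Fin.last (n + 1) from (Fin.castSucc_lt_last _).ne) hjk
    have hl : (Q ∘ σ) (Fin.last n).castSucc = dyadicLeft P := by simp [hσ, hj]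
    have hr : (Q ∘ σ) (Fin.last (n + 1)) = dyadicRight P := by simp [hσ', hk]
    obtain ⟨h, hhK, hh⟩ := ih ((hQ.comp_equiv σ).merge_last hl hr)
    obtain ⟨v, hvK, hv⟩ := exists_perm_vine hX hS hS' hR hR' (n + 1) σ
    -- `h` sends `Q (σ i)` to comb interval `i`, and `v` sends that to comb interval `σ i`.
    refine ⟨v * h, K.mul_mem hvK hhK, fun i => ?_⟩
    obtain ⟨i, rfl⟩ := σ.surjective i
    refine (hv i).mul ?_
    have hP := hh (Fin.last n)
    rw [Fin.lastCases_last, Fin.val_last, dyadicVine_self] at hP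
    change MapsAffine h ((Q ∘ σ) i) _
    cases i using Fin.lastCases with
    | last =>
      rw [hr, Fin.val_last, dyadicVine_self, ← dyadicRight_tail]
      exact hP.right
    | cast i =>
      cases i using Fin.lastCases with
      | last =>
        rw [hl, Fin.val_castSucc, Fin.val_last, dyadicVine_of_lt (Nat.lt_succ_self n)]
        exact hP.left
      | cast i =>
        have := hh i.castSucc
        rw [Fin.lastCases_castSucc, Fin.val_castSucc, dyadicVine_of_lt i.2] at this
        rw [Fin.val_castSucc, Fin.val_castSucc, dyadicVine_of_lt (by omega)]
        exact this

theorem mem_of_mem_thompsonV {g : Equiv.Perm (Set.Ico (0 : ℝ) 1)} (hV : g ∈ thompsonV) :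
    g ∈ K := by
  obtain ⟨L, hL⟩ := mem_thompsonV_iff.1 hV
  choose Q hQ using hL
  have hpos : 0 < 2 ^ L := by positivity
  obtain ⟨n, hn⟩ : ∃ n, 2 ^ L = n + 1 := ⟨2 ^ L - 1, by omega⟩
  have hn' : (2 : ℤ) ^ L = n + 1 := by exact_mod_cast hn
  have hU : IsDyadicPartition fun j : Fin (n + 1) => (L, ((j : ℕ) : ℤ)) := by
    refine ⟨fun j => ⟨by simp, ?_⟩, fun x => ?_, fun x j k hj hk => ?_⟩
    · simp only
      omega
    · obtain ⟨j, hj, hx⟩ := exists_memDyadic_uniform x L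
      exact ⟨⟨j, by omega⟩, hx⟩
    · have := hj.unique hk
      exact Fin.ext (by exact_mod_cast this)
  have hQ' : ∀ j : Fin (n + 1), MapsAffine g (L, ((j : ℕ) : ℤ)) (Q ((j : ℕ) : ℤ)) := fun j => hQ _
  have hP : IsDyadicPartition fun j : Fin (n + 1) => Q ((j : ℕ) : ℤ) := by
    refine ⟨fun j => (hQ' j).valid (hU.valid j), fun x => ?_, fun x j k hj hk => ?_⟩
    · obtain ⟨x, rfl⟩ := g.surjective x
      obtain ⟨j, hj⟩ := hU.cover x
      exact ⟨j, (hQ' j).mem hj⟩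
    · obtain ⟨x, rfl⟩ := g.surjective x
      exact hU.disjoint x j k (((hQ' j).mem_iff (hU.valid j)).1 hj)
        (((hQ' k).mem_iff (hU.valid k)).1 hk)
  obtain ⟨h, hh, hh'⟩ := hU.exists_mapsAffine_vine hX hS hS' hR hR'
  obtain ⟨k, hk, hk'⟩ := hP.exists_mapsAffine_vine hX hS hS' hR hR'
  have e : k * g = h := by
    ext1 x
    obtain ⟨j, hx⟩ := hU.cover x
    exact ((hk' j).mul (hQ' j)).eq_of_mem (hh' j) hx
  rw [← inv_mul_eq_iff_eq_mul.2 e.symm]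
  exact K.mul_mem (K.inv_mem hk) hh

end Generation

theorem thompsonV_fg : thompsonV.FG := by
  refine Subgroup.fg_iff _ |>.2 ⟨{thompsonX, thompsonSwap, tailCopy 1 thompsonSwap, halfTurn,
    tailCopy 1 halfTurn}, le_antisymm ?_ ?_, by simp⟩
  · rw [Subgroup.closure_le]
    intro g hg
    simp only [Set.mem_insert_iff, Set.mem_singleton_iff] at hg
    obtain rfl | rfl | rfl | rfl | rfl := hg
    · exact thompsonX_mem_thompsonV
    · exact thompsonSwap_mem_thompsonV
    · exact dyadicCopy_mem_thompsonV thompsonSwap_mem_thompsonV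
    · exact halfTurn_mem_thompsonV
    · exact dyadicCopy_mem_thompsonV halfTurn_mem_thompsonV
  · intro g hg
    refine mem_of_mem_thompsonV ?_ ?_ ?_ ?_ ?_ hg <;> apply Subgroup.subset_closure <;> simp

/-! ## The groups `F` and `T` as groups of permutations of `[0, 1)` -/

/-- Every slope `2 ^ k` is positive, so `f` increases on the first cell. This rules out orientation
reversal for elements of `F` and `T`; the points avoid `0` and `1` so that they are usable on the
cut-open circle. -/
theorem IsDyadicPL.exists_lt_of_lt {s : Set ℝ} (hs : Set.Ico 0 1 ⊆ s) {f : s → s}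
    (hf : IsDyadicPL f) : ∃ x y : s, (0 : ℝ) < x ∧ (x : ℝ) < y ∧ (y : ℝ) < 1 ∧
      (f x : ℝ) < f y := by
  obtain ⟨N, hN⟩ := hf
  obtain ⟨k, c, -, h⟩ := hN 0
  have hp : (1 : ℝ) ≤ 2 ^ N := one_le_pow₀ (by norm_num)
  have hp0 : (0 : ℝ) < 2 ^ N := by positivity
  have hx1 : 1 / 4 / (2 : ℝ) ^ N < 1 / 2 / 2 ^ N := by gcongr; norm_num
  have hy1 : 1 / 2 / (2 : ℝ) ^ N < 1 := by rw [div_lt_one hp0]; linarith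
  refine ⟨⟨1 / 4 / 2 ^ N, hs ⟨by positivity, hx1.trans hy1⟩⟩,
    ⟨1 / 2 / 2 ^ N, hs ⟨by positivity, hy1⟩⟩, by simp only; positivity, hx1, hy1, ?_⟩
  rw [h _ (by simp only; rw [mul_div_cancel₀ _ hp0.ne']; norm_num)
      (by simp only; rw [mul_div_cancel₀ _ hp0.ne']; norm_num),
    h _ (by simp only; rw [mul_div_cancel₀ _ hp0.ne']; norm_num)
      (by simp only; rw [mul_div_cancel₀ _ hp0.ne']; norm_num)]
  have : (0 : ℝ) < 2 ^ k := by positivity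
  simp only
  nlinarith

theorem thompsonF_strictMono {f : unitInterval ≃ₜ unitInterval} (hf : f ∈ thompsonF) :
    StrictMono f := by
  obtain h | h := f.continuous.strictMono_of_inj_boundedOrder' f.injective
  · exact h
  · obtain ⟨x, y, -, hxy, -, hlt⟩ := IsDyadicPL.exists_lt_of_lt Set.Ico_subset_Icc_self hf
    have h1 : f y < f x := h hxy
    exact absurd (hlt.trans h1) (lt_irrefl _)

theorem thompsonF_apply_one {f : unitInterval ≃ₜ unitInterval} (hf : f ∈ thompsonF) : f 1 = 1 := by
  obtain ⟨x, hx⟩ := f.surjective 1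
  exact le_antisymm unitInterval.le_one'
    (hx.symm.le.trans ((thompsonF_strictMono hf).monotone unitInterval.le_one'))

/-- A point of `[0, 1)`, regarded as a point of `[0, 1]`. -/
def icoToUnit (x : Set.Ico (0 : ℝ) 1) : unitInterval := ⟨x, Set.Ico_subset_Icc_self x.2⟩

theorem thompsonF_apply_mem {f : unitInterval ≃ₜ unitInterval} (hf : f ∈ thompsonF)
    (x : Set.Ico (0 : ℝ) 1) : (f (icoToUnit x) : ℝ) ∈ Set.Ico (0 : ℝ) 1 := by
  refine ⟨(f _).2.1, ?_⟩
  have h : icoToUnit x < 1 := x.2.2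
  have := thompsonF_strictMono hf h
  rw [thompsonF_apply_one hf] at this
  exact this

/-- The embedding of `F` into the permutations of `[0, 1)`. -/
def thompsonFToPerm : thompsonF →* Equiv.Perm (Set.Ico (0 : ℝ) 1) where
  toFun f :=
    { toFun := fun x => ⟨f.1 (icoToUnit x), thompsonF_apply_mem f.2 x⟩
      invFun := fun x => ⟨f⁻¹.1 (icoToUnit x), thompsonF_apply_mem f⁻¹.2 x⟩
      left_inv := fun x => Subtype.ext
        (congrArg (fun u : unitInterval => (u : ℝ)) (f.1.symm_apply_apply (icoToUnit x)))
      right_inv := fun x => Subtype.ext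
        (congrArg (fun u : unitInterval => (u : ℝ)) (f.1.apply_symm_apply (icoToUnit x))) }
  map_one' := rfl
  map_mul' _ _ := rfl

theorem icoToUnit_thompsonFToPerm (f : thompsonF) (x : Set.Ico (0 : ℝ) 1) :
    icoToUnit (thompsonFToPerm f x) = f.1 (icoToUnit x) := rfl

theorem eq_one_or_exists_icoToUnit (x : unitInterval) : x = 1 ∨ ∃ y, x = icoToUnit y := by
  obtain h | h := eq_or_lt_of_le x.2.2
  · exact .inl (Subtype.ext h)
  · exact .inr ⟨⟨x, x.2.1, h⟩, rfl⟩

theorem icoToUnit_injective : Function.Injective icoToUnit := fun _ _ h =>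
  Subtype.ext (congrArg (fun u : unitInterval => (u : ℝ)) h)

theorem thompsonFToPerm_injective : Function.Injective thompsonFToPerm := by
  intro f g h
  apply Subtype.ext
  ext1 x
  obtain rfl | ⟨y, rfl⟩ := eq_one_or_exists_icoToUnit x
  · rw [thompsonF_apply_one f.2, thompsonF_apply_one g.2]
  · rw [← icoToUnit_thompsonFToPerm, h, icoToUnit_thompsonFToPerm]

theorem thompsonFToPerm_mem (f : thompsonF) : thompsonFToPerm f ∈ thompsonV := by
  obtain ⟨N, hN⟩ := f.2
  refine ⟨N, fun j => ?_⟩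
  obtain ⟨k, c, hc, h⟩ := hN j
  exact ⟨k, c, hc, fun x => h (icoToUnit x)⟩

theorem thompsonFToPerm_strictMono (f : thompsonF) : StrictMono (thompsonFToPerm f) :=
  fun _ _ h => thompsonF_strictMono f.2 h

/-- An increasing permutation of `[0, 1)` extends to a homeomorphism of `[0, 1]`. -/
theorem StrictMono.exists_homeomorph_unitInterval {g : Equiv.Perm (Set.Ico (0 : ℝ) 1)}
    (hg : StrictMono g) : ∃ f : unitInterval ≃ₜ unitInterval, f 0 = 0 ∧ f 1 = 1 ∧
      ∀ x, f (icoToUnit x) = icoToUnit (g x) := by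
  classical
  let F : unitInterval → unitInterval := fun x =>
    if h : (x : ℝ) < 1 then icoToUnit (g ⟨x, x.2.1, h⟩) else 1
  have hF : ∀ x, F (icoToUnit x) = icoToUnit (g x) := fun x => dif_pos x.2.2
  have hF1 : F 1 = 1 := dif_neg (lt_irrefl _)
  have hmono : StrictMono F := by
    intro x y hxy
    obtain rfl | ⟨x, rfl⟩ := eq_one_or_exists_icoToUnit x
    · exact absurd hxy (not_lt.2 unitInterval.le_one')
    · obtain rfl | ⟨y, rfl⟩ := eq_one_or_exists_icoToUnit y
      · rw [hF, hF1]
        exact (g x).2.2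
      · rw [hF, hF]
        exact hg hxy
  have hsurj : Function.Surjective F := by
    intro y
    obtain rfl | ⟨y, rfl⟩ := eq_one_or_exists_icoToUnit y
    · exact ⟨1, hF1⟩
    · obtain ⟨x, rfl⟩ := g.surjective y
      exact ⟨_, hF x⟩
  refine ⟨(hmono.orderIsoOfSurjective F hsurj).toHomeomorph, ?_, hF1, hF⟩
  exact (hmono.orderIsoOfSurjective F hsurj).map_bot

theorem exists_thompsonFToPerm_eq {g : Equiv.Perm (Set.Ico (0 : ℝ) 1)} (hg : StrictMono g)
    (hV : g ∈ thompsonV) : ∃ f, thompsonFToPerm f = g := by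
  obtain ⟨f, -, h1, hf⟩ := hg.exists_homeomorph_unitInterval
  have hfF : f ∈ thompsonF := by
    obtain ⟨N, hN⟩ := hV
    refine ⟨N, fun j => ?_⟩
    by_cases hj : j < 2 ^ N
    · obtain ⟨k, c, hc, h⟩ := hN j
      refine ⟨k, c, hc, fun x hx1 hx2 => ?_⟩
      obtain rfl | ⟨x, rfl⟩ := eq_one_or_exists_icoToUnit x
      · exfalso
        have : (j : ℝ) + 1 ≤ 2 ^ N := by exact_mod_cast hj
        have h1 : ((1 : unitInterval) : ℝ) = 1 := rfl
        rw [h1] at hx2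
        linarith
      · exact (congrArg Subtype.val (hf x)).trans (h x hx1 hx2)
    · refine ⟨0, 0, ⟨0, 0, by simp⟩, fun x hx1 _ => ?_⟩
      obtain rfl | ⟨x, rfl⟩ := eq_one_or_exists_icoToUnit x
      · have := congrArg Subtype.val h1
        change (f 1 : ℝ) = _
        rw [this]
        simp
      · exfalso
        have : (2 : ℝ) ^ N ≤ j := by exact_mod_cast not_lt.1 hj
        have hx : (icoToUnit x : ℝ) < 1 := x.2.2
        have hp : (0 : ℝ) < 2 ^ N := by positivity
        nlinarith
  refine ⟨⟨f, hfF⟩, ?_⟩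
  ext1 x
  exact icoToUnit_injective (hf x)

theorem Group.fg_of_injective_of_range_fg {G N : Type*} [Group G] [Group N] {φ : G →* N}
    (hφ : Function.Injective φ) (h : φ.range.FG) : Group.FG G := by
  have : Group.FG φ.range := (Group.fg_iff_subgroup_fg _).2 h
  exact Group.fg_of_surjective (f := (MonoidHom.ofInjective hφ).symm.toMonoidHom)
    (MonoidHom.ofInjective hφ).symm.surjective

theorem thompsonF_fg : Group.FG thompsonF := by
  refine Group.fg_of_injective_of_range_fg thompsonFToPerm_injective ?_
  refine Subgroup.fg_iff _ |>.2 ⟨{thompsonX, tailCopy 1 thompsonX}, le_antisymm ?_ ?_, by simp⟩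
  · rw [Subgroup.closure_le]
    intro g hg
    simp only [Set.mem_insert_iff, Set.mem_singleton_iff] at hg
    obtain rfl | rfl := hg
    · exact exists_thompsonFToPerm_eq thompsonX_strictMono thompsonX_mem_thompsonV
    · exact exists_thompsonFToPerm_eq (dyadicCopy_strictMono thompsonX_strictMono)
        (dyadicCopy_mem_thompsonV thompsonX_mem_thompsonV)
  · rintro _ ⟨f, rfl⟩
    refine mem_of_strictMono_of_mem_thompsonV ?_ ?_ (thompsonFToPerm_strictMono f)
      (thompsonFToPerm_mem f) <;> apply Subgroup.subset_closure <;> simp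

/-! ### `T` as a group of permutations of `[0, 1)` -/

/-- The embedding of `T` into the permutations of `[0, 1)`. -/
noncomputable def thompsonTToPerm : thompsonT →* Equiv.Perm (Set.Ico (0 : ℝ) 1) :=
  (circleEquivIco.permCongrHom.toMonoidHom.comp (homeoToPerm UnitAddCircle)).comp
    thompsonT.subtype

theorem circleEquivIco_symm_apply (x : Set.Ico (0 : ℝ) 1) :
    circleEquivIco.symm x = ((x : ℝ) : UnitAddCircle) := rfl

theorem thompsonTToPerm_apply (t : thompsonT) (x : Set.Ico (0 : ℝ) 1) :
    thompsonTToPerm t x = circleEquivIco (t.1 ((x : ℝ) : UnitAddCircle)) := rfl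

theorem coe_thompsonTToPerm_apply (t : thompsonT) (x : Set.Ico (0 : ℝ) 1) :
    ((thompsonTToPerm t x : ℝ) : UnitAddCircle) = t.1 ((x : ℝ) : UnitAddCircle) := by
  rw [thompsonTToPerm_apply, ← circleEquivIco_symm_apply, Equiv.symm_apply_apply]

theorem thompsonTToPerm_mem (t : thompsonT) : thompsonTToPerm t ∈ thompsonV := t.2

theorem thompsonTToPerm_injective : Function.Injective thompsonTToPerm := by
  intro s t h
  apply Subtype.ext
  ext1 z
  obtain ⟨x, rfl⟩ := circleEquivIco.symm.surjective z
  rw [circleEquivIco_symm_apply, ← coe_thompsonTToPerm_apply, h, coe_thompsonTToPerm_apply]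

/-- A circle homeomorphism fixing `0` restricts to a continuous injection of `(0, 1)`, hence is
monotone there; decrease is excluded by the positive slopes. -/
theorem thompsonTToPerm_strictMono (t : thompsonT)
    (h0 : (thompsonTToPerm t ⟨0, by simp⟩ : ℝ) = 0) : StrictMono (thompsonTToPerm t) := by
  let h : ℝ → ℝ := fun x => circleEquivIco (t.1 (x : UnitAddCircle))
  have hh : ∀ x : Set.Ico (0 : ℝ) 1, h x = thompsonTToPerm t x := fun _ => rfl
  have hpos : ∀ x : Set.Ico (0 : ℝ) 1, (0 : ℝ) < x → (0 : ℝ) < thompsonTToPerm t x := by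
    intro x hx
    refine lt_of_le_of_ne (thompsonTToPerm t x).2.1 fun he => hx.ne ?_
    have := (thompsonTToPerm t).injective (Subtype.ext (h0.trans he))
    exact congrArg Subtype.val this
  have hcont : ContinuousOn h (Set.Ioo 0 1) := by
    intro x hx
    refine ContinuousAt.continuousWithinAt ?_
    -- The coordinate `circleEquivIco` jumps only at `0`, and only `0` is sent there.
    have hne : t.1 (x : UnitAddCircle) ≠ ((0 : ℝ) : UnitAddCircle) := by
      intro he
      have h1 := hpos ⟨x, hx.1.le, hx.2⟩ hx.1
      rw [← hh] at h1
      have h2 : (circleEquivIco ((0 : ℝ) : UnitAddCircle)) = ⟨0, by simp⟩ := by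
        rw [← circleEquivIco.apply_symm_apply ⟨0, by simp⟩]
        rfl
      have h3 : h x = 0 := by
        simp only [h, he, h2]
      simp only [h3] at h1
      exact lt_irrefl _ h1
    have h1 := continuousAt_subtype_val.comp (AddCircle.continuousAt_equivIco (1 : ℝ) 0 hne)
    have h2 : ContinuousAt (fun x : ℝ => t.1 (x : UnitAddCircle)) x :=
      (t.1.continuous.comp (AddCircle.continuous_mk' (1 : ℝ))).continuousAt
    exact ContinuousAt.comp (f := fun x : ℝ => t.1 (x : UnitAddCircle)) h1 h2
  have hinj : Set.InjOn h (Set.Ioo 0 1) := by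
    intro x hx y hy hxy
    have := (thompsonTToPerm t).injective (a₁ := ⟨x, hx.1.le, hx.2⟩) (a₂ := ⟨y, hy.1.le, hy.2⟩)
      (Subtype.ext hxy)
    exact congrArg Subtype.val this
  have hmono : StrictMonoOn h (Set.Ioo 0 1) := by
    obtain hm | hm := hcont.strictMonoOn_of_injOn_Ioo one_pos hinj
    · exact hm
    · obtain ⟨x, y, h1, h2, h3, h4⟩ :=
        IsDyadicPL.exists_lt_of_lt subset_rfl (thompsonTToPerm_mem t)
      have := hm ⟨h1, h2.trans h3⟩ ⟨h1.trans h2, h3⟩ h2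
      exact absurd (h4.trans this) (lt_irrefl _)
  intro x y hxy
  have hy : (0 : ℝ) < y := lt_of_le_of_lt x.2.1 hxy
  obtain hx | hx := eq_or_lt_of_le x.2.1
  · have : x = ⟨0, by simp⟩ := Subtype.ext hx.symm
    rw [this, ← Subtype.coe_lt_coe, h0]
    exact hpos y hy
  · exact hmono ⟨hx, x.2.2⟩ ⟨hy, y.2.2⟩ hxy

theorem StrictMono.continuous_circle {g : Equiv.Perm (Set.Ico (0 : ℝ) 1)} (hg : StrictMono g) :
    Continuous fun z => circleEquivIco.symm (g (circleEquivIco z)) := by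
  obtain ⟨f, h0, h1, hf⟩ := hg.exists_homeomorph_unitInterval
  let F : ℝ → UnitAddCircle := fun x => ((f (Set.projIcc 0 1 zero_le_one x) : ℝ) : UnitAddCircle)
  have e : (fun z => circleEquivIco.symm (g (circleEquivIco z))) = AddCircle.liftIco 1 0 F := by
    funext z
    obtain ⟨x, rfl⟩ := circleEquivIco.symm.surjective z
    rw [Equiv.apply_symm_apply, circleEquivIco_symm_apply, circleEquivIco_symm_apply,
      AddCircle.liftIco_zero_coe_apply x.2]
    simp only [F]
    rw [Set.projIcc_of_mem zero_le_one (Set.Ico_subset_Icc_self x.2)]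
    exact congrArg (fun u : unitInterval => ((u : ℝ) : UnitAddCircle)) (hf x).symm
  rw [e]
  apply AddCircle.liftIco_zero_continuous
  · simp only [F]
    rw [Set.projIcc_left, Set.projIcc_right]
    change ((f 0 : ℝ) : UnitAddCircle) = ((f 1 : ℝ) : UnitAddCircle)
    rw [h0, h1]
    simpa using (AddCircle.coe_period (1 : ℝ)).symm
  · exact ((AddCircle.continuous_mk' (1 : ℝ)).comp (continuous_subtype_val.comp
      (f.continuous.comp continuous_projIcc))).continuousOn

theorem StrictMono.perm_symm {α : Type*} [LinearOrder α] {g : Equiv.Perm α} (hg : StrictMono g) :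
    StrictMono g.symm := by
  intro x y hxy
  rw [← hg.lt_iff_lt, g.apply_symm_apply, g.apply_symm_apply]
  exact hxy

theorem exists_thompsonTToPerm_eq {g : Equiv.Perm (Set.Ico (0 : ℝ) 1)} (hV : g ∈ thompsonV)
    (hg : Continuous fun z => circleEquivIco.symm (g (circleEquivIco z)))
    (hg' : Continuous fun z => circleEquivIco.symm (g.symm (circleEquivIco z))) :
    ∃ t, thompsonTToPerm t = g := by
  let t : UnitAddCircle ≃ₜ UnitAddCircle :=
    { toEquiv := circleEquivIco.permCongr.symm g
      continuous_toFun := hg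
      continuous_invFun := hg' }
  have ht : circleEquivIco.permCongrHom (homeoToPerm _ t) = g :=
    circleEquivIco.permCongr.apply_symm_apply g
  refine ⟨⟨t, ?_⟩, ht⟩
  change circleEquivIco.permCongrHom (homeoToPerm _ t) ∈ thompsonV
  rwa [ht]

theorem StrictMono.exists_thompsonTToPerm_eq {g : Equiv.Perm (Set.Ico (0 : ℝ) 1)}
    (hg : StrictMono g) (hV : g ∈ thompsonV) : ∃ t, thompsonTToPerm t = g :=
  _root_.exists_thompsonTToPerm_eq hV hg.continuous_circle hg.perm_symm.continuous_circle

theorem halfTurn_continuous_circle :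
    Continuous fun z => circleEquivIco.symm (halfTurn (circleEquivIco z)) := by
  have e : (fun z => circleEquivIco.symm (halfTurn (circleEquivIco z))) =
      fun z => z + ((1 / 2 : ℝ) : UnitAddCircle) := by
    funext z
    obtain ⟨x, rfl⟩ := circleEquivIco.symm.surjective z
    rw [Equiv.apply_symm_apply, circleEquivIco_symm_apply, circleEquivIco_symm_apply,
      halfTurn_apply, ← AddCircle.coe_add]
    split_ifs
    · rfl
    · rw [← AddCircle.coe_add_period (1 : ℝ) ((x : ℝ) - 1 / 2)]
      congr 1
      ring
  rw [e]
  exact continuous_id.add continuous_const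

/-! ### Moving a dyadic point to `0`, and generation of `T` -/

section Generation

variable {K : Subgroup (Equiv.Perm (Set.Ico (0 : ℝ) 1))} (hX : thompsonX ∈ K)
  (hR : halfTurn ∈ K)

include hX hR in
-- The inverse of `thompsonX` moves `1 - 2 ^ (-(b + 2))` to `1 - 2 ^ (-(b + 1))`; iterating reaches
-- `1/2`, which the half turn sends to `0`.
theorem exists_apply_eq_zero_of_eq_one_sub (b : ℕ) (x : Set.Ico (0 : ℝ) 1)
    (hx : (2 : ℝ) ^ (b + 1) * (x : ℝ) = 2 ^ (b + 1) - 1) : ∃ k ∈ K, (k x : ℝ) = 0 := by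
  induction b generalizing x with
  | zero =>
    refine ⟨halfTurn, hR, ?_⟩
    norm_num at hx
    rw [halfTurn_apply]
    split_ifs <;> linarith
  | succ b ih =>
    obtain ⟨y, rfl⟩ := thompsonX.surjective x
    have hp : (0 : ℝ) < 2 ^ b := by positivity
    have hp1 : (1 : ℝ) ≤ 2 ^ b := one_le_pow₀ (by norm_num)
    have hx' : (3 / 4 : ℝ) ≤ thompsonX y := by
      rw [pow_succ, pow_succ] at hx
      nlinarith
    have hy : (thompsonX y : ℝ) = (y + 1) / 2 := by
      rw [thompsonX_apply] at hx' ⊢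
      split_ifs at hx' ⊢ <;> linarith
    obtain ⟨k, hk, hky⟩ := ih y (by
      rw [hy] at hx
      rw [pow_succ _ (b + 1)] at hx
      linarith)
    exact ⟨k * thompsonX⁻¹, K.mul_mem hk (K.inv_mem hX), by simpa using hky⟩

include hX hR in
-- The image of `0` is a left endpoint of a uniform dyadic cell. Moving that uniform partition to
-- the comb takes it to `0` or to some `1 - 2 ^ (-(b + 1))`.
theorem exists_apply_eq_zero (hX' : tailCopy 1 thompsonX ∈ K) {g : Equiv.Perm (Set.Ico (0 : ℝ) 1)}
    (hV : g ∈ thompsonV) : ∃ k ∈ K, (k (g ⟨0, by simp⟩) : ℝ) = 0 := by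
  obtain ⟨L, hL⟩ := mem_thompsonV_iff.1 hV
  obtain ⟨⟨m, b⟩, hJ⟩ := hL 0
  have h0 : MemDyadic ⟨0, by simp⟩ (L, 0) := by constructor <;> simp
  have hd := hJ _ h0
  obtain ⟨hb0, hb1⟩ := (hJ.mem h0).valid
  have hdm := hJ.mem h0
  simp only [mul_zero, Int.cast_zero, sub_zero, sub_eq_zero] at hd
  simp only at hb0 hb1
  lift b to ℕ using hb0
  set d := g ⟨0, by simp⟩
  obtain _ | b := b
  · refine ⟨1, K.one_mem, ?_⟩
    simpa using hd
  · obtain ⟨h, hh, hh'⟩ := exists_mapsAffine_vine hX hX' (isSortedPartition_uniform m)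
    have hbm : b + 1 ≤ 2 ^ m - 1 := by
      have : b + 1 < 2 ^ m := by exact_mod_cast hb1
      omega
    have h1 := hh' (b + 1) hbm d hdm
    simp only [hd, sub_self] at h1
    have h2 : (2 : ℝ) ^ (b + 1) * (h d : ℝ) = 2 ^ (b + 1) - 1 := by
      obtain hlt | heq := lt_or_eq_of_le hbm
      · rw [dyadicVine_of_lt hlt] at h1
        simp only [dyadicLeft, dyadicTail] at h1
        rw [pow_succ] at h1
        push_cast at h1
        linarith
      · rw [← heq, dyadicVine_self] at h1
        simp only [dyadicTail] at h1
        push_cast at h1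
        linarith
    obtain ⟨k, hk, hk0⟩ := exists_apply_eq_zero_of_eq_one_sub hX hR b _ h2
    exact ⟨k * h, K.mul_mem hk hh, hk0⟩

end Generation

theorem thompsonT_fg : Group.FG thompsonT := by
  refine Group.fg_of_injective_of_range_fg thompsonTToPerm_injective ?_
  have hle : Subgroup.closure {thompsonX, tailCopy 1 thompsonX, halfTurn} ≤
      thompsonTToPerm.range := by
    rw [Subgroup.closure_le]
    intro g hg
    simp only [Set.mem_insert_iff, Set.mem_singleton_iff] at hg
    obtain rfl | rfl | rfl := hg
    · exact thompsonX_strictMono.exists_thompsonTToPerm_eq thompsonX_mem_thompsonV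
    · exact (dyadicCopy_strictMono thompsonX_strictMono).exists_thompsonTToPerm_eq
        (dyadicCopy_mem_thompsonV thompsonX_mem_thompsonV)
    · exact exists_thompsonTToPerm_eq halfTurn_mem_thompsonV halfTurn_continuous_circle
        halfTurn_continuous_circle
  refine Subgroup.fg_iff _ |>.2 ⟨{thompsonX, tailCopy 1 thompsonX, halfTurn},
    le_antisymm hle ?_, by simp⟩
  rintro _ ⟨t, rfl⟩
  set K := Subgroup.closure {thompsonX, tailCopy 1 thompsonX, halfTurn}
  have hX : thompsonX ∈ K := Subgroup.subset_closure (by simp)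
  have hX' : tailCopy 1 thompsonX ∈ K := Subgroup.subset_closure (by simp)
  have hR : halfTurn ∈ K := Subgroup.subset_closure (by simp)
  obtain ⟨k, hk, hk0⟩ := exists_apply_eq_zero hX hR hX' (thompsonTToPerm_mem t)
  obtain ⟨s, rfl⟩ := hle hk
  -- The corrected element fixes `0`, hence is increasing, and falls under the case of `F`.
  have hst : thompsonTToPerm (s * t) ∈ K :=
    mem_of_strictMono_of_mem_thompsonV hX hX'
      (thompsonTToPerm_strictMono _ (by rw [map_mul]; exact hk0)) (thompsonTToPerm_mem _)
  rw [map_mul] at hst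
  exact (K.mul_mem_cancel_left hk).1 hst

/-! ## Ends of the pairs -/

theorem memDyadic_half_iff {x : Set.Ico (0 : ℝ) 1} : MemDyadic x (1, 0) ↔ (x : ℝ) < 1 / 2 := by
  have := x.2.1
  constructor
  · rintro ⟨-, h⟩
    norm_num at h
    linarith
  · intro h
    constructor <;> norm_num <;> linarith

theorem lt_thompsonX {x : Set.Ico (0 : ℝ) 1} (hx : (0 : ℝ) < x) : x < thompsonX x := by
  have := x.2.2
  rw [← Subtype.coe_lt_coe, thompsonX_apply]
  split_ifs <;> linarith

theorem thompsonX_zero : thompsonX ⟨0, by simp⟩ = ⟨0, by simp⟩ := by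
  apply Subtype.ext
  rw [thompsonX_apply]
  norm_num

theorem thompsonX_pow_strictMono :
    StrictMono fun n : ℕ => (thompsonX ^ n) ⟨1 / 2, by norm_num⟩ := by
  have h0 : ∀ n : ℕ, (0 : ℝ) < (thompsonX ^ n) ⟨1 / 2, by norm_num⟩ := by
    intro n
    induction n with
    | zero => norm_num
    | succ n ih =>
      rw [pow_succ', Equiv.Perm.mul_apply]
      exact ih.trans (lt_thompsonX ih)
  refine strictMono_nat_of_lt_succ fun n => ?_
  rw [pow_succ', Equiv.Perm.mul_apply]
  exact lt_thompsonX (h0 n)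

theorem thompsonX_inv_pow_maps (n : ℕ) :
    MapsAffine ((thompsonX ^ n)⁻¹) (1, 0) (n + 1, 0) := by
  have h1 : ∀ n : ℕ, MapsAffine thompsonX (n + 2, 0) (n + 1, 0) := by
    intro n
    induction n with
    | zero => exact thompsonX_maps_left
    | succ n ih => exact ih.left
  have h2 : MapsAffine (thompsonX ^ n) (n + 1, 0) (1, 0) := by
    induction n with
    | zero => exact .one _
    | succ n ih =>
      rw [pow_succ]
      exact ih.mul (h1 n)
  exact h2.inv ⟨le_rfl, by simp only; positivity⟩

theorem dyadicValid_quarter : DyadicValid (2, 1) := by constructor <;> norm_num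

/-- A copy of the standard element of `F` with support in `[1/4, 1/2)`. -/
noncomputable def quarterX : Equiv.Perm (Set.Ico (0 : ℝ) 1) :=
  dyadicCopy (2, 1) dyadicValid_quarter thompsonX

theorem quarterX_strictMono : StrictMono quarterX := dyadicCopy_strictMono thompsonX_strictMono

theorem quarterX_mem_thompsonV : quarterX ∈ thompsonV :=
  dyadicCopy_mem_thompsonV thompsonX_mem_thompsonV

theorem quarterX_pow (n : ℕ) :
    quarterX ^ n = dyadicCopy (2, 1) dyadicValid_quarter (thompsonX ^ n) := dyadicCopy_pow n

theorem quarterX_pow_zero (n : ℕ) : (quarterX ^ n) ⟨0, by simp⟩ = ⟨0, by simp⟩ := by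
  rw [quarterX_pow, dyadicCopy_of_notMem]
  rintro ⟨h, -⟩
  norm_num at h

/-- Besides `0`, this supplies the second common fixed point in `[0, 1/2)`, enough to pin down an
affine map. -/
theorem quarterX_pow_quarter (n : ℕ) :
    (quarterX ^ n) ⟨1 / 4, by norm_num⟩ = ⟨1 / 4, by norm_num⟩ := by
  have e : (⟨1 / 4, by norm_num⟩ : Set.Ico (0 : ℝ) 1) =
      (dyadicCoord (2, 1) dyadicValid_quarter ⟨0, by simp⟩).1 := by
    apply eq_of_two_pow_mul_eq 2
    rw [two_pow_mul_dyadicCoord (2, 1)]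
    norm_num
  have h0 : (thompsonX ^ n) ⟨0, by simp⟩ = ⟨0, by simp⟩ := by
    induction n with
    | zero => rfl
    | succ n ih => rw [pow_succ, Equiv.Perm.mul_apply, thompsonX_zero, ih]
  rw [e, quarterX_pow, dyadicCopy_coord, h0]

theorem quarterX_pow_lt_half_iff (n : ℕ) (x : Set.Ico (0 : ℝ) 1) :
    ((quarterX ^ n) x : ℝ) < 1 / 2 ↔ (x : ℝ) < 1 / 2 := by
  have key : ∀ z : Set.Ico (0 : ℝ) 1, MemDyadic z (2, 1) → (z : ℝ) < 1 / 2 := by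
    rintro z ⟨-, h⟩
    norm_num at h
    linarith
  rw [quarterX_pow]
  by_cases hx : MemDyadic x (2, 1)
  · exact iff_of_true (key _ (dyadicCopy_memDyadic_iff.2 hx)) (key _ hx)
  · rw [dyadicCopy_of_notMem hx]

/-- The orbit of `1/2` under `thompsonX` is strictly increasing; its rescaled copy inside `[1/4,
1/2)` separates the powers. -/
theorem eq_of_quarterX_pow_eqOn {i k : ℕ}
    (h : ∀ x : Set.Ico (0 : ℝ) 1, (x : ℝ) < 1 / 2 → (quarterX ^ i) x = (quarterX ^ k) x) :
    i = k := by
  have hm := (dyadicCoord (2, 1) dyadicValid_quarter ⟨1 / 2, by norm_num⟩).2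
  have hlt := hm.2
  norm_num at hlt
  have := h (dyadicCoord (2, 1) dyadicValid_quarter ⟨1 / 2, by norm_num⟩).1 (by
    norm_num
    linarith)
  rw [quarterX_pow, quarterX_pow, dyadicCopy_coord, dyadicCopy_coord] at this
  exact thompsonX_pow_strictMono.injective
    ((dyadicCoord (2, 1) dyadicValid_quarter).injective (Subtype.ext this))

/-! ### Disjoint almost invariant sets of cosets -/

section Ends

variable {G : Type*} [Group G] {φ : G →* Equiv.Perm (Set.Ico (0 : ℝ) 1)} {H : Subgroup G}

/-- The set of cosets `H g` such that `g⁻¹ * b` maps `[0, 1/2)` affinely onto a standard dyadic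
interval. -/
def affineCosets (φ : G →* Equiv.Perm (Set.Ico (0 : ℝ) 1)) (H : Subgroup G) (b : G) :
    Set (Quotient (QuotientGroup.rightRel H)) :=
  {q | ∃ g, q = rightCosetMk H g ∧ ∃ J, MapsAffine (φ (g⁻¹ * b)) (1, 0) J}

variable (hH : ∀ g, g ∈ H ↔ ∀ x : Set.Ico (0 : ℝ) 1, (x : ℝ) < 1 / 2 → φ g x = x)

include hH

theorem rightCosetMk_eq_iff_eqOn {g h : G} : rightCosetMk H g = rightCosetMk H h ↔
    ∀ x : Set.Ico (0 : ℝ) 1, (x : ℝ) < 1 / 2 → φ g⁻¹ x = φ h⁻¹ x := by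
  rw [rightCosetMk_eq, hH]
  refine forall₂_congr fun x _ => ?_
  rw [map_mul, Equiv.Perm.mul_apply, map_inv φ h, Equiv.Perm.eq_inv_iff_eq]

/-- Since `b` permutes `[0, 1/2)`, precomposing with it loses no information about a coset. So
membership in `affineCosets` does not depend on the representative. -/
theorem rightCosetMk_eq_iff_eqOn_mul {b : G}
    (hb : ∀ x : Set.Ico (0 : ℝ) 1, (φ b x : ℝ) < 1 / 2 ↔ (x : ℝ) < 1 / 2) {g h : G} :
    rightCosetMk H g = rightCosetMk H h ↔
      ∀ x : Set.Ico (0 : ℝ) 1, (x : ℝ) < 1 / 2 → φ (g⁻¹ * b) x = φ (h⁻¹ * b) x := by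
  rw [rightCosetMk_eq_iff_eqOn hH]
  constructor
  · intro h x hx
    rw [map_mul, map_mul, Equiv.Perm.mul_apply, Equiv.Perm.mul_apply, h _ ((hb x).2 hx)]
  · intro h x hx
    obtain ⟨x, rfl⟩ := (φ b).surjective x
    have := h x ((hb x).1 hx)
    rwa [map_mul, map_mul, Equiv.Perm.mul_apply, Equiv.Perm.mul_apply] at this

theorem rightCosetMk_mem_affineCosets {b : G}
    (hb : ∀ x : Set.Ico (0 : ℝ) 1, (φ b x : ℝ) < 1 / 2 ↔ (x : ℝ) < 1 / 2) {g : G} :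
    rightCosetMk H g ∈ affineCosets φ H b ↔ ∃ J, MapsAffine (φ (g⁻¹ * b)) (1, 0) J := by
  constructor
  · rintro ⟨h, e, J, hJ⟩
    refine ⟨J, fun x hx => ?_⟩
    rw [(rightCosetMk_eq_iff_eqOn_mul hH hb).1 e x (memDyadic_half_iff.1 hx)]
    exact hJ x hx
  · exact fun h => ⟨g, rfl, h⟩

theorem affineCosets_almost_invariant (hV : ∀ g, φ g ∈ thompsonV) {b : G}
    (hb : ∀ x : Set.Ico (0 : ℝ) 1, (φ b x : ℝ) < 1 / 2 ↔ (x : ℝ) < 1 / 2) (s : G) :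
    {q | ∃ g, q = rightCosetMk H g ∧ q ∈ affineCosets φ H b ∧
      rightCosetMk H (g * s) ∉ affineCosets φ H b}.Finite := by
  obtain ⟨L, hL⟩ := mem_thompsonV_iff.1 (hV s⁻¹)
  let T : Set (ℕ × ℤ) := Set.Iio L ×ˢ Set.Ico 0 (2 ^ L)
  have hT : T.Finite := (Set.finite_Iio L).prod (Set.finite_Ico _ _)
  have key : ∀ q ∈ {q | ∃ g, q = rightCosetMk H g ∧ q ∈ affineCosets φ H b ∧
      rightCosetMk H (g * s) ∉ affineCosets φ H b},
      ∃ J ∈ T, ∃ g, q = rightCosetMk H g ∧ MapsAffine (φ (g⁻¹ * b)) (1, 0) J := by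
    rintro q ⟨g, rfl, hg, hgs⟩
    obtain ⟨J, hJ⟩ := (rightCosetMk_mem_affineCosets hH hb).1 hg
    -- If `J` had level at least `L`, then `s⁻¹` would be affine on `J` and the coset of `g * s`
    -- would remain in the set.
    have hlt : J.1 < L := by
      by_contra! hle
      apply hgs
      rw [rightCosetMk_mem_affineCosets hH hb]
      obtain ⟨J', hJ'⟩ := hL.mono hle J.2
      refine ⟨J', ?_⟩
      rw [mul_inv_rev, mul_assoc, map_mul]
      exact hJ'.mul hJ
    obtain ⟨h0, h1⟩ := hJ.valid ⟨le_rfl, by norm_num⟩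
    exact ⟨J, ⟨hlt, h0, h1.trans_le (pow_le_pow_right₀ (by norm_num) hlt.le)⟩, g, rfl, hJ⟩
  choose! f hfT hf using key
  -- The image interval determines the affine map on `[0, 1/2)` and hence the coset, so there are no
  -- more exceptional cosets than short intervals.
  refine Set.Finite.of_injOn (f := f) (fun q hq => hfT q hq) ?_ hT
  intro q hq r hr hqr
  obtain ⟨g, hg, hgJ⟩ := hf q hq
  obtain ⟨h, hh, hhJ⟩ := hf r hr
  rw [← hqr] at hhJ
  rw [hg, hh, rightCosetMk_eq_iff_eqOn_mul hH hb]
  exact fun x hx => hgJ.eq_of_mem hhJ (memDyadic_half_iff.2 hx)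

theorem affineCosets_infinite (hX : thompsonX ∈ φ.range) {b : G}
    (hb : ∀ x : Set.Ico (0 : ℝ) 1, (φ b x : ℝ) < 1 / 2 ↔ (x : ℝ) < 1 / 2) :
    (affineCosets φ H b).Infinite := by
  obtain ⟨a, ha⟩ := hX
  have hmaps : ∀ n : ℕ, MapsAffine (φ ((b * a ^ n)⁻¹ * b)) (1, 0) (n + 1, 0) := by
    intro n
    rw [mul_inv_rev, inv_mul_cancel_right, map_inv, map_pow, ha]
    exact thompsonX_inv_pow_maps n
  refine Set.infinite_of_injective_forall_mem (f := fun n : ℕ => rightCosetMk H (b * a ^ n)) ?_ ?_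
  · intro n m hnm
    -- Any nonzero point of `[0, 1/2)` would do: its images under contractions by different powers
    -- of two differ.
    have hlt : ((⟨1 / 4, by norm_num⟩ : Set.Ico (0 : ℝ) 1) : ℝ) < 1 / 2 := by norm_num
    have h1 := (rightCosetMk_eq_iff_eqOn_mul hH hb).1 hnm ⟨1 / 4, by norm_num⟩ hlt
    have hn := hmaps n _ (memDyadic_half_iff.2 hlt)
    have hm := hmaps m _ (memDyadic_half_iff.2 hlt)
    rw [h1] at hn
    have h2 := hn.trans hm.symm
    simp only [Int.cast_zero, sub_zero] at h2 hm
    have hne : (φ ((b * a ^ m)⁻¹ * b) ⟨1 / 4, by norm_num⟩ : ℝ) ≠ 0 := by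
      intro h0
      rw [h0] at hm
      norm_num at hm
    have h3 := mul_right_cancel₀ hne h2
    have := pow_right_injective₀ (show (0 : ℝ) < 2 by norm_num) (by norm_num) h3
    omega
  · exact fun n => (rightCosetMk_mem_affineCosets hH hb).2 ⟨_, hmaps n⟩

theorem affineCosets_disjoint {a : G} (ha : φ a = quarterX) {i k : ℕ} (hik : i ≠ k) :
    Disjoint (affineCosets φ H (a ^ i)) (affineCosets φ H (a ^ k)) := by
  have hb : ∀ i, ∀ x : Set.Ico (0 : ℝ) 1, (φ (a ^ i) x : ℝ) < 1 / 2 ↔ (x : ℝ) < 1 / 2 := by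
    intro i x
    rw [map_pow, ha]
    exact quarterX_pow_lt_half_iff i x
  rw [Set.disjoint_left]
  intro q hq hq'
  obtain ⟨g, rfl⟩ := exists_rightCosetMk H q
  obtain ⟨I, hI⟩ := (rightCosetMk_mem_affineCosets hH (hb i)).1 hq
  obtain ⟨J, hJ⟩ := (rightCosetMk_mem_affineCosets hH (hb k)).1 hq'
  rw [map_mul, map_pow, ha] at hI hJ
  apply hik
  have m0 : MemDyadic ⟨0, by simp⟩ (1, 0) := memDyadic_half_iff.2 (by norm_num)
  have m1 : MemDyadic ⟨1 / 4, by norm_num⟩ (1, 0) := memDyadic_half_iff.2 (by norm_num)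
  have i0 := hI _ m0
  have j0 := hJ _ m0
  have i1 := hI _ m1
  have j1 := hJ _ m1
  rw [Equiv.Perm.mul_apply, quarterX_pow_zero] at i0 j0
  rw [Equiv.Perm.mul_apply, quarterX_pow_quarter] at i1 j1
  set u := (φ g⁻¹ ⟨0, by simp⟩ : ℝ)
  set v := (φ g⁻¹ ⟨1 / 4, by norm_num⟩ : ℝ)
  norm_num at i0 j0 i1 j1
  -- Both affine maps take the value `u` at `0` and `v` at `1/4`; the difference gives equal scales,
  -- and the value at `0` equal offsets.
  have hvu : v - u ≠ 0 := by
    intro h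
    have : (2 : ℝ) ^ I.1 * (v - u) = 1 / 2 := by linarith
    rw [h] at this
    norm_num at this
  have e : (2 : ℝ) ^ I.1 = 2 ^ J.1 := by
    apply mul_right_cancel₀ hvu
    linarith
  have e' : (I.2 : ℝ) = J.2 := by
    rw [e] at i0
    linarith
  refine eq_of_quarterX_pow_eqOn fun x hx => (φ g⁻¹).injective ?_
  have hi := hI x (memDyadic_half_iff.2 hx)
  have hj := hJ x (memDyadic_half_iff.2 hx)
  rw [e, e'] at hi
  exact eq_of_two_pow_mul_eq J.1 (by simpa using hi.trans hj.symm)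

/-- Let a finitely generated group `G` act on `[0, 1)` through `V`, in such a way that all
increasing elements of `V` come from `G`. If `H` is the pointwise stabilizer of `[0, 1/2)`, then
`(G, H)` has infinitely many ends. -/
theorem pairHasEnds_top [hfg : Group.FG G] (hV : ∀ g, φ g ∈ thompsonV)
    (hmono : ∀ f ∈ thompsonV, StrictMono f → f ∈ φ.range) : PairHasEnds H ⊤ := by
  refine ⟨hfg, fun S hS => ?_⟩
  obtain ⟨a, ha⟩ := hmono _ quarterX_mem_thompsonV quarterX_strictMono
  have hb : ∀ i, ∀ x : Set.Ico (0 : ℝ) 1, (φ (a ^ i) x : ℝ) < 1 / 2 ↔ (x : ℝ) < 1 / 2 := by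
    intro i x
    rw [map_pow, ha]
    exact quarterX_pow_lt_half_iff i x
  exact numEnds_cosetGraph_eq_top H S hS (fun i => affineCosets φ H (a ^ i))
    (fun i k => affineCosets_disjoint hH ha)
    (fun i => affineCosets_infinite hH
      (hmono _ thompsonX_mem_thompsonV thompsonX_strictMono) (hb i))
    (fun i s => affineCosets_almost_invariant hH hV (hb i) s)

end Ends

/-! ### The stabilizers in `F`, `T` and `V` -/

theorem mem_thompsonFFix_iff {g : thompsonF} : g ∈ thompsonFFix (Set.Ico 0 (1 / 2)) ↔
    ∀ x : Set.Ico (0 : ℝ) 1, (x : ℝ) < 1 / 2 → thompsonFToPerm g x = x := by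
  constructor
  · exact fun h x hx => icoToUnit_injective (h (icoToUnit x) ⟨x.2.1, hx⟩)
  · intro h x hx
    exact congrArg icoToUnit (h ⟨x, hx.1, by linarith [hx.2]⟩ hx.2)

theorem mem_thompsonTFix_iff {g : thompsonT} : g ∈ thompsonTFix (Set.Ico 0 (1 / 2)) ↔
    ∀ x : Set.Ico (0 : ℝ) 1, (x : ℝ) < 1 / 2 → thompsonTToPerm g x = x := by
  have key : ∀ x : Set.Ico (0 : ℝ) 1, thompsonTToPerm g x = x ↔
      g.1 ((x : ℝ) : UnitAddCircle) = ((x : ℝ) : UnitAddCircle) := by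
    intro x
    rw [← circleEquivIco.symm.injective.eq_iff, circleEquivIco_symm_apply,
      circleEquivIco_symm_apply, coe_thompsonTToPerm_apply]
  simp only [key]
  constructor
  · exact fun h x hx => h x ⟨x.2.1, hx⟩
  · exact fun h x hx => h ⟨x, hx.1, by linarith [hx.2]⟩ hx.2

theorem mem_thompsonVFix_iff {g : thompsonV} : g ∈ thompsonVFix (Set.Ico 0 (1 / 2)) ↔
    ∀ x : Set.Ico (0 : ℝ) 1, (x : ℝ) < 1 / 2 → thompsonV.subtype g x = x :=
  ⟨fun h x hx => h x ⟨x.2.1, hx⟩, fun h x hx => h x hx.2⟩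

/-- The fixed-point set of a homeomorphism is closed, so it contains `1/2` once it contains `[0,
1/2)`. Extending by `projIcc` lets the closure be taken in `ℝ`. -/
theorem thompsonFFix_Icc : thompsonFFix (Set.Icc 0 (1 / 2)) = thompsonFFix (Set.Ico 0 (1 / 2)) := by
  refine le_antisymm (fun g h x hx => h x (Set.Ico_subset_Icc_self hx)) fun g h x hx => ?_
  let p : ℝ → unitInterval := Set.projIcc 0 1 zero_le_one
  have hc : IsClosed {y : ℝ | g.1 (p y) = p y} :=
    isClosed_eq (g.1.continuous.comp continuous_projIcc) continuous_projIcc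
  have hsub : Set.Ico (0 : ℝ) (1 / 2) ⊆ {y : ℝ | g.1 (p y) = p y} := by
    intro y hy
    refine h (p y) ?_
    have : p y = ⟨y, hy.1, by linarith [hy.2]⟩ := Set.projIcc_of_mem _ _
    rw [this]
    exact hy
  have hx' := hc.closure_subset_iff.2 hsub (by rwa [closure_Ico (by norm_num)])
  have : p x = x := Set.projIcc_val zero_le_one x
  rwa [Set.mem_ofPred_eq, this] at hx'

theorem thompsonTFix_Icc : thompsonTFix (Set.Icc 0 (1 / 2)) = thompsonTFix (Set.Ico 0 (1 / 2)) := by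
  refine le_antisymm (fun g h x hx => h x (Set.Ico_subset_Icc_self hx)) fun g h x hx => ?_
  have hc : IsClosed {y : ℝ | g.1 (y : UnitAddCircle) = (y : UnitAddCircle)} :=
    isClosed_eq (g.1.continuous.comp (AddCircle.continuous_mk' _)) (AddCircle.continuous_mk' _)
  exact hc.closure_subset_iff.2 (fun y hy => h y hy) (by rwa [closure_Ico (by norm_num)])

theorem theorem1p1 :
    (PairHasEnds (thompsonFFix (Set.Icc 0 (1 / 2))) ⊤ ∧
      PairHasEnds (thompsonFFix (Set.Ico 0 (1 / 2))) ⊤) ∧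
    (PairHasEnds (thompsonTFix (Set.Icc 0 (1 / 2))) ⊤ ∧
      PairHasEnds (thompsonTFix (Set.Ico 0 (1 / 2))) ⊤) ∧
    PairHasEnds (thompsonVFix (Set.Ico 0 (1 / 2))) ⊤ := by
  have := thompsonF_fg
  have := thompsonT_fg
  have := (Group.fg_iff_subgroup_fg _).2 thompsonV_fg
  have hF : PairHasEnds (thompsonFFix (Set.Ico 0 (1 / 2))) ⊤ :=
    pairHasEnds_top (fun _ => mem_thompsonFFix_iff) thompsonFToPerm_mem
      fun _ hV hf => exists_thompsonFToPerm_eq hf hV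
  have hT : PairHasEnds (thompsonTFix (Set.Ico 0 (1 / 2))) ⊤ :=
    pairHasEnds_top (fun _ => mem_thompsonTFix_iff) thompsonTToPerm_mem
      fun _ hV hf => hf.exists_thompsonTToPerm_eq hV
  have hV : PairHasEnds (thompsonVFix (Set.Ico 0 (1 / 2))) ⊤ :=
    pairHasEnds_top (fun _ => mem_thompsonVFix_iff) (fun g => g.2) fun f hV _ => ⟨⟨f, hV⟩, rfl⟩
  rw [thompsonFFix_Icc, thompsonTFix_Icc]
  exact ⟨⟨hF, hF⟩, ⟨hT, hT⟩, hV⟩
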